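/- For $\alpha\ge -1/2$ let $d\mu_\alpha(x)=x^{2\alpha+1}\,dx$ on $\mathbb{R}_+=(0,\infty)$, and let $$\ell_k^{\alpha}(x)=\Big(\frac{2\Gamma(k+1)}{\Gamma(k+\alpha+1)}\Big)^{1/2}L_k^{\alpha}(x^2)e^{-x^2/2},\qquad x>0,\ k=0,1,2,\dots,$$ be the Laguerre functions of convolution type, where $L_k^\alpha$ is the Laguerre polynomial of degree $k$ and order $\alpha$. Let $$G_{\alpha,t}(x,y)=\sum_{k=0}^\infty e^{-t(4k+2\alpha+2)}\ell_k^\alpha(x)\ell_k^\alpha(y),\qquad t>0,\ x,y>0,$$ be the Laguerre heat kernel, put $\delta_\alpha=\frac{d}{dx}+x$ (acting in the variable $x$), and let $$R^{\alpha}(x,y)=\frac1{\sqrt\pi}\int_0^\infty \delta_\alpha G_{\alpha,t}(x,y)\,t^{-1/2}\,dt,\qquad x,y>0,\ x\ne y,$$ be the kernel of the Laguerre Riesz transform. **Proposition.** Let $\alpha\ge-1/2$. There are constants $C_1,C_2$, depending only on $\alpha$, such that for all real $a\ge1$, all integers $j\ge0$ and all $x,y>0$ with $x\ne y$ the following holds.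 The series defining $G_{\alpha+aj,t}(x,y)$ converges and its sum is differentiable in $x$ for every $t>0$, the integral defining $R^{\alpha+aj}(x,y)$ converges absolutely, and $$|(xy)^{aj}R^{\alpha+aj}(x,y)|\le\frac{C_1}{\mu_\alpha(B(x,|x-y|))}.$$ Moreover, the function $(x,y)\mapsto (xy)^{aj}R^{\alpha+aj}(x,y)$ is differentiable at the point $(x,y)$, and $$\big|\nabla_{x,y}\big[(xy)^{aj}R^{\alpha+aj}(x,y)\big]\big|\le\frac{C_2}{|x-y|\,\mu_\alpha(B(x,|x-y|))}.$$ Here $B(x,|x-y|)=\{z>0: |z-x|<|x-y|\}$. In particular, $C_1$ and $C_2$ do not depend on $j$. -/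

import Mathlib

namespace LaguerreRiesz

noncomputable section

/-- The measure `dμ_α(x) = x ^ (2α+1) dx` on the half-line `(0, ∞)`, viewed as a measure on `ℝ`
that is concentrated on `(0, ∞)`. The measure of a ball of `(0, ∞)` is thus the measure of the
ball of `ℝ` with the same centre and radius. -/
def mu (α : ℝ) : MeasureTheory.Measure ℝ :=
  (MeasureTheory.volume.restrict (Set.Ioi (0 : ℝ))).withDensity
    (fun x => ENNReal.ofReal (x ^ (2 * α + 1)))

/-- The Laguerre polynomial `L_k^α` of degree `k` and order `α > -1`. -/
def laguerrePoly (α : ℝ) (k : ℕ) (u : ℝ) : ℝ :=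
  ∑ i ∈ Finset.range (k + 1),
    Real.Gamma ((k : ℝ) + α + 1) / Real.Gamma ((i : ℝ) + α + 1) *
      ((-u) ^ i / ((i.factorial : ℝ) * ((k - i).factorial : ℝ)))

/-- The Laguerre function of convolution type `ℓ_k^α`. -/
def laguerreFun (α : ℝ) (k : ℕ) (x : ℝ) : ℝ :=
  Real.sqrt (2 * Real.Gamma ((k : ℝ) + 1) / Real.Gamma ((k : ℝ) + α + 1)) *
    laguerrePoly α k (x ^ 2) * Real.exp (-x ^ 2 / 2)

/-- The general term of the series of the heat kernel:
`exp (-t (4k + 2α + 2)) ℓ_k^α(x) ℓ_k^α(y)`. -/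
def heatTerm (α t x y : ℝ) (k : ℕ) : ℝ :=
  Real.exp (-(t * (4 * (k : ℝ) + 2 * α + 2))) * laguerreFun α k x * laguerreFun α k y

/-- The Laguerre heat kernel `G_{α,t}(x,y)`. -/
def heatKernel (α t x y : ℝ) : ℝ :=
  ∑' k : ℕ, heatTerm α t x y k

/-- The derivative `δ_α = d/dx + x`, as an operator on functions on the half-line. -/
def delta (f : ℝ → ℝ) (x : ℝ) : ℝ :=
  deriv f x + x * f x

/-- The integrand `δ_α G_{α,t}(x,y) t ^ (-1/2)` of the Riesz kernel, with `δ_α` acting in `x`. -/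
def rieszIntegrand (α x y t : ℝ) : ℝ :=
  delta (fun x' => heatKernel α t x' y) x * t ^ (-(1 / 2) : ℝ)

/-- The kernel `R^α(x,y)` of the Riesz transform `δ_α (L_α)^(-1/2)`. -/
def rieszKernel (α x y : ℝ) : ℝ :=
  1 / Real.sqrt Real.pi * ∫ t in Set.Ioi (0 : ℝ), rieszIntegrand α x y t

/-- The kernel `(xy)^b R^(α+b)(x,y)` of the conjugated operator `x^b 𝓡^(α+b) (x^(-b) ·)` with
respect to `μ_α`. -/
def conjKernel (α b x y : ℝ) : ℝ :=
  (x * y) ^ b * rieszKernel (α + b) x y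

/-- The same kernel, as a function on the Euclidean plane. -/
def conjKernelPlane (α b : ℝ) (p : EuclideanSpace ℝ (Fin 2)) : ℝ :=
  conjKernel α b (p 0) (p 1)

end

end LaguerreRiesz

open Filter Topology MeasureTheory

namespace LaguerreRiesz

noncomputable section

/-! ### Estimates for the Gamma function -/

/-! Write b = aj. The Hille–Hardy formula (`hasSum_hilleHardy`) sums the heat kernel of order α + b
in closed form with the modified Bessel function I_{α+b}. Put s = 1/sinh 2t, w = xys and h_b(w) =
w^(-α) e^(-w) I_{α+b}(w) (`conjBessel`). After multiplication by (xy)^b, the kernel under the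
t-integral becomes s^(α+1) times a Gaussian factor times s(y h_{b+1}(w) - x h_b(w)) + (1 - tanh t) x
h_b(w) (`conjIntegrand_eq`). So b enters only through h_b and h_{b+1}, and uniformity in j reduces
to bounds on h_b that are uniform in b.

These bounds are `conjBessel_bounds`: up to a constant depending on α alone, h_b is at most (1 +
w)^(-α-1/2), the difference h_b - h_{b+1} gains a further (1 + w)^(-1/2), and h_b' gains (1 +
w)^(-1). They hold for b = 0 and b ≥ 1, which covers every aj with a ≥ 1. For w ≤ 1 they come from
the power series. For w ≥ 1 the main point is `besselH_decay`: e^(-w) I_β(w) √w is at most a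
constant times (1 + β²/w)^(-1) when β ≥ 1/2, and this decay pays for the factors β that differences
and derivatives produce. The decay comes from iterating (1 + β/w) I_{β+1} ≤ I_β
(`mul_besselH_succ_le`), which follows from a variance inequality for the weights of the Bessel
series and the three-term recurrence.

For fixed t, everything is measured by N = 1 + tanh t (x+y)² + (x-y)²/tanh t. The Gaussian factor is
a constant times exp(-N/4) and absorbs all powers of N. This bounds the integrand by (x+y)^(-2α-1)
(t + (x-y)²)^(-3/2) and its gradient by the same expression with exponent -2
(`conjIntegrand_bounds`). Integration in t gives (x+y)^(-2α-1) |x-y|^(-1) and (x+y)^(-2α-1)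
|x-y|^(-2), and the measure of the ball is at most a constant times (x+y)^(2α+1) |x-y|. -/

lemma half_le_Gamma {x : ℝ} (hx : 1 / 2 ≤ x) : 1 / 2 ≤ Real.Gamma x := by
  have h2 : ∀ y : ℝ, 2 ≤ y → 1 ≤ Real.Gamma y := fun y hy => by
    rw [← Real.Gamma_two]
    exact Real.Gamma_strictMonoOn_Ici.monotoneOn (by simp) hy hy
  have h1 : ∀ y : ℝ, 1 ≤ y → 1 / 2 ≤ Real.Gamma y := fun y hy => by
    rcases le_total 2 y with h | h
    · linarith [h2 y h]
    · have h3 := h2 (y + 1) (by linarith)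
      rw [Real.Gamma_add_one (by positivity)] at h3
      nlinarith [Real.Gamma_pos_of_pos (show 0 < y by linarith)]
  rcases le_total 1 x with h | h
  · exact h1 x h
  · have h3 := h1 (x + 1) (by linarith)
    have hx0 : 0 < x := by linarith
    rw [Real.Gamma_add_one hx0.ne'] at h3
    nlinarith [Real.Gamma_pos_of_pos hx0]

/-- Log-convexity of Γ at x + 1 = δ(x + δ) + (1 - δ)(x + δ + 1); the factor 2 absorbs (1 +
δ/x)^(1-δ). It serves to compare Bessel coefficients of order between 1/2 and 3/2 with those at the
endpoints. -/
lemma Gamma_mul_rpow_le {x δ : ℝ} (hx : 1 ≤ x) (h0 : 0 ≤ δ) (h1 : δ ≤ 1) :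
    Real.Gamma x * x ^ δ ≤ 2 * Real.Gamma (x + δ) := by
  have hx0 : 0 < x := by linarith
  have hG := Real.Gamma_pos_of_pos hx0
  rcases h0.eq_or_lt with rfl | h0
  · simp; linarith
  rcases h1.eq_or_lt with rfl | h1
  · rw [Real.rpow_one, Real.Gamma_add_one hx0.ne']; nlinarith
  have hxd : 0 < x + δ := by linarith
  have hGd := Real.Gamma_pos_of_pos hxd
  have key := Real.Gamma_mul_add_mul_le_rpow_Gamma_mul_rpow_Gamma (s := x + δ) (t := x + δ + 1)
    (a := δ) (b := 1 - δ) hxd (by linarith) h0 (by linarith) (by ring)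
  rw [show δ * (x + δ) + (1 - δ) * (x + δ + 1) = x + 1 by ring, Real.Gamma_add_one hx0.ne',
    Real.Gamma_add_one hxd.ne', Real.mul_rpow hxd.le hGd.le, mul_left_comm,
    ← Real.rpow_add hGd, show δ + (1 - δ) = 1 by ring, Real.rpow_one] at key
  have h2 : (x + δ) ^ (1 - δ) ≤ 2 * x ^ (1 - δ) := by
    calc (x + δ) ^ (1 - δ) ≤ (2 * x) ^ (1 - δ) := by
          apply Real.rpow_le_rpow hxd.le (by linarith) (by linarith)
      _ = 2 ^ (1 - δ) * x ^ (1 - δ) := Real.mul_rpow (by norm_num) hx0.le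
      _ ≤ 2 * x ^ (1 - δ) := by
          gcongr
          calc (2 : ℝ) ^ (1 - δ) ≤ 2 ^ (1 : ℝ) :=
                Real.rpow_le_rpow_of_exponent_le (by norm_num) (by linarith)
            _ = 2 := Real.rpow_one _
  have h3 : x = x ^ δ * x ^ (1 - δ) := by
    rw [← Real.rpow_add hx0]; simp
  have h4 : 0 < x ^ (1 - δ) := by positivity
  have h5 : (Real.Gamma x * x ^ δ) * x ^ (1 - δ) ≤ (2 * Real.Gamma (x + δ)) * x ^ (1 - δ) := by
    calc (Real.Gamma x * x ^ δ) * x ^ (1 - δ) = x * Real.Gamma x := by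
          rw [mul_assoc, ← h3, mul_comm]
      _ ≤ (x + δ) ^ (1 - δ) * Real.Gamma (x + δ) := key
      _ ≤ (2 * x ^ (1 - δ)) * Real.Gamma (x + δ) := by gcongr
      _ = _ := by ring
  exact le_of_mul_le_mul_right h5 h4

/-! ### The entire function behind the modified Bessel function -/

/-- The coefficients of `besselE`. -/
def besselCoeff (β : ℝ) (m : ℕ) : ℝ :=
  1 / ((m.factorial : ℝ) * Real.Gamma ((m : ℝ) + β + 1))

/-- The entire function `∑ z ^ m / (m! Γ(m + β + 1))`, so that the modified Bessel function is
`I_β(w) = (w / 2) ^ β * besselE β (w ^ 2 / 4)`. -/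
def besselE (β z : ℝ) : ℝ := ∑' m : ℕ, besselCoeff β m * z ^ m

lemma besselCoeff_pos {β : ℝ} (hβ : -(1 / 2) ≤ β) (m : ℕ) : 0 < besselCoeff β m := by
  have h := half_le_Gamma (show 1 / 2 ≤ (m : ℝ) + β + 1 by linarith [m.cast_nonneg (α := ℝ)])
  have : (0 : ℝ) < m.factorial := by positivity
  unfold besselCoeff
  positivity

lemma besselCoeff_le {β : ℝ} (hβ : -(1 / 2) ≤ β) (m : ℕ) :
    besselCoeff β m ≤ 2 * (1 / (m.factorial : ℝ)) := by
  have h := half_le_Gamma (show 1 / 2 ≤ (m : ℝ) + β + 1 by linarith [m.cast_nonneg (α := ℝ)])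
  have : (0 : ℝ) < m.factorial := by positivity
  unfold besselCoeff
  rw [mul_one_div, div_le_div_iff₀ (by positivity) this]
  nlinarith

lemma besselCoeff_eq {β : ℝ} (hβ : -(1 / 2) ≤ β) (m : ℕ) :
    besselCoeff β m = ((m : ℝ) + β + 1) * besselCoeff (β + 1) m := by
  have h0 : (0 : ℝ) < (m : ℝ) + β + 1 := by linarith [m.cast_nonneg (α := ℝ)]
  have h1 := Real.Gamma_pos_of_pos h0
  have : (0 : ℝ) < m.factorial := by positivity
  unfold besselCoeff
  rw [show (m : ℝ) + (β + 1) + 1 = (m + β + 1) + 1 by ring, Real.Gamma_add_one h0.ne']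
  field_simp

lemma besselCoeff_succ (β : ℝ) (m : ℕ) :
    ((m : ℝ) + 1) * besselCoeff β (m + 1) = besselCoeff (β + 1) m := by
  unfold besselCoeff
  rw [Nat.factorial_succ]
  push_cast
  rw [show (m : ℝ) + (β + 1) + 1 = m + 1 + β + 1 by ring]
  field_simp

lemma summable_besselE {β : ℝ} (hβ : -(1 / 2) ≤ β) (z : ℝ) :
    Summable (fun m : ℕ => besselCoeff β m * z ^ m) := by
  refine Summable.of_norm_bounded ((Real.summable_pow_div_factorial |z|).mul_left 2) fun m => ?_
  rw [norm_mul, norm_pow, Real.norm_eq_abs, Real.norm_eq_abs, abs_of_pos (besselCoeff_pos hβ m)]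
  calc besselCoeff β m * |z| ^ m ≤ 2 * (1 / (m.factorial : ℝ)) * |z| ^ m := by
        gcongr; exact besselCoeff_le hβ m
    _ = _ := by ring

lemma summable_besselE_mul {β : ℝ} (hβ : -(1 / 2) ≤ β) (z : ℝ) :
    Summable (fun m : ℕ => (m : ℝ) * besselCoeff β m * z ^ m) := by
  rw [← summable_nat_add_iff 1]
  refine ((summable_besselE (β := β + 1) (by linarith) z).mul_left z).congr fun m => ?_
  push_cast
  rw [besselCoeff_succ]
  ring

lemma tsum_besselE_mul {β : ℝ} (hβ : -(1 / 2) ≤ β) (z : ℝ) :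
    ∑' m : ℕ, (m : ℝ) * besselCoeff β m * z ^ m = z * besselE (β + 1) z := by
  rw [(summable_besselE_mul hβ z).tsum_eq_zero_add]
  simp only [Nat.cast_zero, zero_mul, zero_add, besselE]
  rw [← tsum_mul_left]
  refine tsum_congr fun m => ?_
  push_cast
  rw [besselCoeff_succ]
  ring

lemma besselE_pos {β : ℝ} (hβ : -(1 / 2) ≤ β) {z : ℝ} (hz : 0 ≤ z) : 0 < besselE β z := by
  refine (summable_besselE hβ z).tsum_pos (fun m => ?_) 0 ?_
  · have := besselCoeff_pos hβ m; positivity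
  · simpa using besselCoeff_pos hβ 0

lemma hasDerivAt_besselE {β : ℝ} (hβ : -(1 / 2) ≤ β) (z : ℝ) :
    HasDerivAt (besselE β) (besselE (β + 1) z) z := by
  have hs : Summable fun m : ℕ => (m : ℝ) * besselCoeff β m * (|z| + 1) ^ (m - 1) := by
    rw [← summable_nat_add_iff 1]
    refine (summable_besselE (β := β + 1) (by linarith) (|z| + 1)).congr fun m => ?_
    push_cast
    rw [besselCoeff_succ]
  have h := hasDerivAt_tsum_of_isPreconnected (t := Metric.ball (0 : ℝ) (|z| + 1))
    (g := fun (m : ℕ) y => besselCoeff β m * y ^ m)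
    (g' := fun (m : ℕ) y => besselCoeff β m * (m * y ^ (m - 1))) (y₀ := 0) (y := z)
    hs Metric.isOpen_ball (convex_ball _ _).isPreconnected
    (fun m y _ => (hasDerivAt_pow m y).const_mul _) (fun m y hy => ?_)
    (by simp [add_pos_of_nonneg_of_pos]) (summable_besselE hβ 0) (by simp)
  · refine HasDerivAt.congr_deriv (f := besselE β) h ?_
    have h2 : Summable fun m : ℕ => besselCoeff β m * (m * z ^ (m - 1)) := by
      rw [← summable_nat_add_iff 1]
      refine (summable_besselE (β := β + 1) (by linarith) z).congr fun m => ?_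
      rw [← besselCoeff_succ]
      push_cast
      ring
    rw [h2.tsum_eq_zero_add]
    simp only [besselE, Nat.cast_zero, zero_mul, mul_zero, zero_add]
    refine tsum_congr fun m => ?_
    rw [← besselCoeff_succ]
    push_cast
    ring
  · simp only [Metric.mem_ball, dist_zero_right, Real.norm_eq_abs] at hy
    have := besselCoeff_pos hβ m
    rw [norm_mul, norm_mul, norm_pow, Real.norm_eq_abs, Real.norm_eq_abs, Real.norm_eq_abs,
      abs_of_pos this, Nat.abs_cast]
    calc besselCoeff β m * (m * |y| ^ (m - 1)) ≤ besselCoeff β m * (m * (|z| + 1) ^ (m - 1)) := by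
          gcongr
      _ = _ := by ring

lemma besselE_recurrence {β : ℝ} (hβ : -(1 / 2) ≤ β) (z : ℝ) :
    besselE β z = z * besselE (β + 2) z + (β + 1) * besselE (β + 1) z := by
  have hβ' : -(1 / 2) ≤ β + 1 := by linarith
  rw [show β + 2 = β + 1 + 1 by ring, ← tsum_besselE_mul hβ' z, besselE, besselE, ← tsum_mul_left,
    ← (summable_besselE_mul hβ' z).tsum_add ((summable_besselE hβ' z).mul_left _)]
  refine tsum_congr fun m => ?_
  rw [besselCoeff_eq hβ]
  ring

/-- Nonnegativity of the variance of the weights `besselCoeff (β + 1) m * z ^ m`. -/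
lemma besselE_variance {β : ℝ} (hβ : -(1 / 2) ≤ β) {z : ℝ} (hz : 0 ≤ z) (l : ℝ) :
    (2 * l + β + 1) * (z * besselE (β + 2) z) ≤ (z + l ^ 2) * besselE (β + 1) z := by
  have hβ' : -(1 / 2) ≤ β + 1 := by linarith
  -- The coefficient recursion turns m(m + β + 1) into a first moment at order β, so the second
  -- moment is again expressed by `besselE`.
  have hsq : ∀ m : ℕ, (m : ℝ) * (m + β + 1) * besselCoeff (β + 1) m * z ^ m =
      (m : ℝ) * besselCoeff β m * z ^ m := fun m => by
    rw [besselCoeff_eq hβ]; ring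
  have s0 := summable_besselE hβ' z
  have s1 := summable_besselE_mul hβ' z
  have s2 := summable_besselE_mul hβ z
  have h : 0 ≤ ∑' m : ℕ, ((m : ℝ) - l) ^ 2 * (besselCoeff (β + 1) m * z ^ m) := by
    refine tsum_nonneg fun m => ?_
    have := besselCoeff_pos hβ' m
    positivity
  have h2 : ∑' m : ℕ, ((m : ℝ) - l) ^ 2 * (besselCoeff (β + 1) m * z ^ m) =
      z * besselE (β + 1) z - (2 * l + β + 1) * (z * besselE (β + 2) z)
        + l ^ 2 * besselE (β + 1) z := by
    rw [show β + 2 = β + 1 + 1 by ring, ← tsum_besselE_mul hβ' z, ← tsum_besselE_mul hβ z,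
      ← tsum_mul_left, besselE, ← tsum_mul_left, ← s2.tsum_sub (s1.mul_left _),
      ← (s2.sub (s1.mul_left _)).tsum_add (s0.mul_left _)]
    refine tsum_congr fun m => ?_
    rw [← hsq]
    ring
  linarith

/-! ### The exponentially scaled modified Bessel function -/

/-- `e ^ (-w) I_β(w)`. -/
def besselH (β w : ℝ) : ℝ := (w / 2) ^ β * Real.exp (-w) * besselE β (w ^ 2 / 4)

lemma besselH_pos {β w : ℝ} (hβ : -(1 / 2) ≤ β) (hw : 0 < w) : 0 < besselH β w := by
  have := besselE_pos hβ (show 0 ≤ w ^ 2 / 4 by positivity)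
  unfold besselH
  positivity

lemma besselH_add_one (β : ℝ) {w : ℝ} (hw : 0 < w) :
    besselH (β + 1) w = (w / 2) ^ β * Real.exp (-w) * (w / 2 * besselE (β + 1) (w ^ 2 / 4)) := by
  rw [besselH, Real.rpow_add_one (by positivity)]
  ring

lemma besselH_add_two (β : ℝ) {w : ℝ} (hw : 0 < w) :
    besselH (β + 2) w =
      (w / 2) ^ β * Real.exp (-w) * (w ^ 2 / 4 * besselE (β + 2) (w ^ 2 / 4)) := by
  rw [show β + 2 = β + 1 + 1 by ring, besselH_add_one _ hw, Real.rpow_add_one (by positivity)]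
  ring

lemma besselH_recurrence {β w : ℝ} (hβ : -(1 / 2) ≤ β) (hw : 0 < w) :
    besselH β w = besselH (β + 2) w + 2 * (β + 1) / w * besselH (β + 1) w := by
  rw [besselH_add_two β hw, besselH_add_one β hw, besselH, besselE_recurrence hβ]
  field_simp

/-! ### Comparison of consecutive orders. -/

lemma besselH_le_mul_succ {β w : ℝ} (hβ : -(1 / 2) ≤ β) (hw : 0 < w) :
    besselH β w ≤
      (1 + (β + 1) / w + ((β + 1) / w) ^ 2 / 2) * besselH (β + 1) w := by
  -- The optimal centre is (√(w² + (β+1)²) - (β+1))/2. Replacing the root by w gives 2l + β + 1 = w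
  -- and keeps the bound rational.
  have h := besselE_variance hβ (show 0 ≤ w ^ 2 / 4 by positivity) ((w - (β + 1)) / 2)
  have hr := besselE_recurrence hβ (w ^ 2 / 4)
  rw [besselH_add_one β hw, besselH, mul_left_comm]
  refine mul_le_mul_of_nonneg_left ?_ (by positivity)
  have h3 : w * besselE β (w ^ 2 / 4) ≤
      w * ((1 + (β + 1) / w + ((β + 1) / w) ^ 2 / 2) *
        (w / 2 * besselE (β + 1) (w ^ 2 / 4))) := by
    have h4 : w * ((1 + (β + 1) / w + ((β + 1) / w) ^ 2 / 2) *
        (w / 2 * besselE (β + 1) (w ^ 2 / 4))) =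
        (w ^ 2 / 2 + w * (β + 1) / 2 + (β + 1) ^ 2 / 4) * besselE (β + 1) (w ^ 2 / 4) := by
      field_simp
      ring
    rw [h4, hr]
    linarith
  exact le_of_mul_le_mul_left h3 hw

/-- With e = (β+1)/w, the case e ≥ 1 is trivial, and otherwise (1 - e)(1 + e + e²/2) = 1 - e²/2 -
e³/2 ≤ 1 inverts the preceding bound. -/
lemma besselH_sub_succ_le {β w : ℝ} (hβ : -(1 / 2) ≤ β) (hw : 0 < w) :
    besselH β w - besselH (β + 1) w ≤ (β + 1) / w * besselH β w := by
  have h := besselH_le_mul_succ hβ hw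
  have h0 := besselH_pos hβ hw
  have h1 := besselH_pos (show -(1 / 2) ≤ β + 1 by linarith) hw
  have he : 0 ≤ (β + 1) / w := div_nonneg (by linarith) hw.le
  set e := (β + 1) / w
  rcases le_total 1 e with h2 | h2
  · nlinarith
  · have h3 : (1 - e) * besselH β w ≤ (1 - e) * ((1 + e + e ^ 2 / 2) * besselH (β + 1) w) :=
      mul_le_mul_of_nonneg_left h (by linarith)
    have h4 : (1 - e) * (1 + e + e ^ 2 / 2) ≤ 1 := by nlinarith [pow_nonneg he 3, pow_nonneg he 2]
    nlinarith

/-- The recurrence reverses the previous inequality taken at order β + 1: the coefficient is 1 -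
(β+2)/w + 2(β+1)/w. The gain β/w is the source of the decay in the order. -/
lemma mul_besselH_succ_le {β w : ℝ} (hβ : -(1 / 2) ≤ β) (hw : 0 < w) :
    (1 + β / w) * besselH (β + 1) w ≤ besselH β w := by
  have h := besselH_sub_succ_le (show -(1 / 2) ≤ β + 1 by linarith) hw
  have hr := besselH_recurrence hβ hw
  rw [show β + 1 + 1 = β + 2 by ring] at h
  have : (1 + β / w) * besselH (β + 1) w = besselH (β + 1) w -
      (β + 2) / w * besselH (β + 1) w + 2 * (β + 1) / w * besselH (β + 1) w := by
    field_simp; ring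
  linarith

lemma besselH_succ_le {β w : ℝ} (hβ : 0 ≤ β) (hw : 0 < w) :
    besselH (β + 1) w ≤ besselH β w := by
  have h := mul_besselH_succ_le (show -(1 / 2) ≤ β by linarith) hw
  have h1 := besselH_pos (show -(1 / 2) ≤ β + 1 by linarith) hw
  have : 0 ≤ β / w := by positivity
  nlinarith

/-! ### Decay of the scaled Bessel function in its argument and its order. -/

lemma besselH_half_le {w : ℝ} (hw : 0 < w) : besselH (1 / 2) w * √w ≤ 1 := by
  -- The right side equals (2m+1)! √π/2, which is the identity of I_{1/2} with a multiple of
  -- w^(-1/2) sinh w. The weaker constant 1/2 suffices and needs only a lower bound for Γ(3/2).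
  have hc : ∀ m : ℕ, (((2 * m + 1).factorial : ℕ) : ℝ) / 2 ≤
      (m.factorial : ℝ) * Real.Gamma ((m : ℝ) + 1 / 2 + 1) * 4 ^ m := fun m => by
    induction m with
    | zero =>
      have := half_le_Gamma (show (1 : ℝ) / 2 ≤ 1 / 2 + 1 by norm_num)
      simpa using this
    | succ m ih =>
      have e1 : (((2 * (m + 1) + 1).factorial : ℕ) : ℝ) =
          (2 * m + 3) * (2 * m + 2) * ((2 * m + 1).factorial : ℕ) := by
        rw [show 2 * (m + 1) + 1 = (2 * m + 1) + 1 + 1 by ring, Nat.factorial_succ,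
          Nat.factorial_succ]
        push_cast
        ring
      have e2 : Real.Gamma (((m + 1 : ℕ) : ℝ) + 1 / 2 + 1) =
          ((m : ℝ) + 1 / 2 + 1) * Real.Gamma ((m : ℝ) + 1 / 2 + 1) := by
        rw [← Real.Gamma_add_one (by positivity)]
        congr 1
        push_cast
        ring
      rw [e1, e2, Nat.factorial_succ m, pow_succ, Nat.cast_mul, Nat.cast_add_one]
      nlinarith [mul_le_mul_of_nonneg_left ih
        (show (0 : ℝ) ≤ (2 * m + 3) * (2 * m + 2) by positivity)]
  have hE : w * besselE (1 / 2) (w ^ 2 / 4) ≤ 2 * Real.sinh w := by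
    rw [besselE, ← tsum_mul_left, (Real.hasSum_sinh w).tsum_eq.symm, ← tsum_mul_left]
    refine Summable.tsum_le_tsum (fun m => ?_)
      ((summable_besselE (by norm_num) _).mul_left _) ((Real.hasSum_sinh w).summable.mul_left _)
    have h := hc m
    have hg := Real.Gamma_pos_of_pos (show 0 < (m : ℝ) + 1 / 2 + 1 by positivity)
    have h5 : w * (besselCoeff (1 / 2) m * (w ^ 2 / 4) ^ m) =
        w ^ (2 * m + 1) / ((m.factorial : ℝ) * Real.Gamma ((m : ℝ) + 1 / 2 + 1) * 4 ^ m) := by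
      rw [besselCoeff, div_pow, ← pow_mul, pow_succ]
      field_simp
    rw [h5, ← mul_div_assoc, div_le_div_iff₀ (by positivity) (by positivity)]
    have := pow_pos hw (2 * m + 1)
    nlinarith
  have hs : 2 * Real.sinh w ≤ Real.exp w := by
    rw [Real.sinh_eq]; linarith [Real.exp_pos (-w)]
  have hsq : (w / 2) ^ (1 / 2 : ℝ) * √w ≤ w := by
    rw [← Real.sqrt_eq_rpow]
    calc √(w / 2) * √w ≤ √w * √w := by
          gcongr; linarith
      _ = w := Real.mul_self_sqrt hw.le
  have hEp := besselE_pos (show -(1 / 2) ≤ (1 / 2 : ℝ) by norm_num)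
    (show 0 ≤ w ^ 2 / 4 by positivity)
  calc besselH (1 / 2) w * √w
      = ((w / 2) ^ (1 / 2 : ℝ) * √w) * (Real.exp (-w) * besselE (1 / 2) (w ^ 2 / 4)) := by
        rw [besselH]; ring
    _ ≤ w * (Real.exp (-w) * besselE (1 / 2) (w ^ 2 / 4)) := by gcongr
    _ = Real.exp (-w) * (w * besselE (1 / 2) (w ^ 2 / 4)) := by ring
    _ ≤ Real.exp (-w) * Real.exp w := by gcongr; linarith
    _ = 1 := by rw [← Real.exp_add]; simp

lemma rpow_le_one_add {q δ : ℝ} (hq : 0 ≤ q) (h0 : 0 ≤ δ) (h1 : δ ≤ 1) : q ^ δ ≤ 1 + q := by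
  rcases le_total q 1 with h | h
  · linarith [Real.rpow_le_one hq h h0]
  · have := Real.rpow_le_rpow_of_exponent_le h h1
    rw [Real.rpow_one] at this
    linarith

/-- Interpolation in the order: with x = m + 3/2 and δ = β - 1/2, write X^δ = x^δ (X/x)^δ. The first
factor is absorbed by the Gamma quotient, the second is at most 1 + X/x, and the two summands are
the terms of order 1/2 and 3/2. -/
lemma rpow_mul_besselCoeff_le {β X : ℝ} (h0 : 1 / 2 ≤ β) (h1 : β ≤ 3 / 2) (hX : 0 < X) (m : ℕ) :
    X ^ β * besselCoeff β m ≤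
      2 * (X ^ (1 / 2 : ℝ) * besselCoeff (1 / 2) m + X ^ (3 / 2 : ℝ) * besselCoeff (3 / 2) m) := by
  set x : ℝ := (m : ℝ) + 1 / 2 + 1 with hx
  have hx1 : 1 ≤ x := by linarith [m.cast_nonneg (α := ℝ)]
  have hx0 : 0 < x := by linarith
  have hG := Real.Gamma_pos_of_pos hx0
  have hδ0 : 0 ≤ β - 1 / 2 := by linarith
  have hGd := Real.Gamma_pos_of_pos (show 0 < x + (β - 1 / 2) by linarith)
  have h2 := Gamma_mul_rpow_le hx1 hδ0 (by linarith)
  have h3 := rpow_le_one_add (show 0 ≤ X / x by positivity) hδ0 (by linarith)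
  have hm : (0 : ℝ) < m.factorial := by positivity
  have e1 : X ^ β = X ^ (1 / 2 : ℝ) * (x ^ (β - 1 / 2) * (X / x) ^ (β - 1 / 2)) := by
    rw [← Real.mul_rpow hx0.le (by positivity), mul_div_cancel₀ _ hx0.ne', ← Real.rpow_add hX]
    congr 1; ring
  have e2 : X ^ (3 / 2 : ℝ) = X ^ (1 / 2 : ℝ) * X := by
    rw [← Real.rpow_add_one hX.ne']; norm_num
  have e3 : (m : ℝ) + β + 1 = x + (β - 1 / 2) := by rw [hx]; ring
  have e4 : (m : ℝ) + 3 / 2 + 1 = x + 1 := by rw [hx]; ring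
  unfold besselCoeff
  rw [e1, e2, e3, e4, ← hx, Real.Gamma_add_one hx0.ne']
  have h4 : x ^ (β - 1 / 2) / Real.Gamma (x + (β - 1 / 2)) ≤ 2 / Real.Gamma x := by
    rw [div_le_div_iff₀ hGd hG]; linarith
  calc X ^ (1 / 2 : ℝ) * (x ^ (β - 1 / 2) * (X / x) ^ (β - 1 / 2)) *
        (1 / (m.factorial * Real.Gamma (x + (β - 1 / 2))))
      = X ^ (1 / 2 : ℝ) / m.factorial *
        ((x ^ (β - 1 / 2) / Real.Gamma (x + (β - 1 / 2))) * (X / x) ^ (β - 1 / 2)) := by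
        field_simp
    _ ≤ X ^ (1 / 2 : ℝ) / m.factorial * ((2 / Real.Gamma x) * (1 + X / x)) := by gcongr
    _ = _ := by field_simp

lemma besselH_le_of_mem_Icc {β w : ℝ} (h0 : 1 / 2 ≤ β) (h1 : β ≤ 3 / 2) (hw : 0 < w) :
    besselH β w * √w ≤ 4 := by
  have hE : (w / 2) ^ β * besselE β (w ^ 2 / 4) ≤
      2 * ((w / 2) ^ (1 / 2 : ℝ) * besselE (1 / 2) (w ^ 2 / 4) +
        (w / 2) ^ (3 / 2 : ℝ) * besselE (3 / 2) (w ^ 2 / 4)) := by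
    have s1 := (summable_besselE (show -(1 / 2) ≤ β by linarith) (w ^ 2 / 4)).mul_left
      ((w / 2) ^ β)
    have s2 := (summable_besselE (show -(1 / 2) ≤ (1 / 2 : ℝ) by norm_num) (w ^ 2 / 4)).mul_left
      ((w / 2) ^ (1 / 2 : ℝ))
    have s3 := (summable_besselE (show -(1 / 2) ≤ (3 / 2 : ℝ) by norm_num) (w ^ 2 / 4)).mul_left
      ((w / 2) ^ (3 / 2 : ℝ))
    unfold besselE
    rw [← tsum_mul_left, ← tsum_mul_left, ← tsum_mul_left, ← s2.tsum_add s3, ← tsum_mul_left]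
    refine Summable.tsum_le_tsum (fun m => ?_) s1 ((s2.add s3).mul_left 2)
    have h := mul_le_mul_of_nonneg_right
      (rpow_mul_besselCoeff_le h0 h1 (show 0 < w / 2 by positivity) m)
      (show 0 ≤ (w ^ 2 / 4) ^ m by positivity)
    linarith
  have h2 : besselH β w ≤ 2 * (besselH (1 / 2) w + besselH (3 / 2) w) := by
    have := mul_le_mul_of_nonneg_left hE (Real.exp_pos (-w)).le
    unfold besselH
    linarith
  have h3 := besselH_succ_le (show (0 : ℝ) ≤ 1 / 2 by norm_num) hw
  rw [show (1 : ℝ) / 2 + 1 = 3 / 2 by norm_num] at h3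
  have h4 := besselH_half_le hw
  have := Real.sqrt_nonneg w
  nlinarith

/-- The factors 1 + (β+k)/w accumulate to at least 1 + n²/(2w); the induction closes exactly because
2β ≥ 1. -/
lemma besselH_add_nat_le {β w : ℝ} (h0 : 1 / 2 ≤ β) (hw : 0 < w) (n : ℕ) :
    (1 + (n : ℝ) ^ 2 / (2 * w)) * besselH (β + n) w ≤ besselH β w := by
  induction n with
  | zero => simp
  | succ n ih =>
    have hn : (0 : ℝ) ≤ n := n.cast_nonneg
    have h := mul_besselH_succ_le (show -(1 / 2) ≤ β + n by linarith) hw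
    have hp := besselH_pos (show -(1 / 2) ≤ β + n + 1 by linarith) hw
    push_cast
    rw [← add_assoc]
    refine le_trans ?_ ih
    refine le_trans ?_ (mul_le_mul_of_nonneg_left h (by positivity))
    rw [← mul_assoc]
    refine mul_le_mul_of_nonneg_right ?_ hp.le
    have e : (1 + (n : ℝ) ^ 2 / (2 * w)) * (1 + (β + n) / w) - (1 + ((n : ℝ) + 1) ^ 2 / (2 * w)) =
        (β - 1 / 2) / w + (n : ℝ) ^ 2 / (2 * w) * ((β + n) / w) := by
      field_simp; ring
    have : 0 ≤ (β - 1 / 2) / w := div_nonneg (by linarith) hw.le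
    have : 0 ≤ (n : ℝ) ^ 2 / (2 * w) * ((β + n) / w) := by
      have : 0 ≤ β + n := by linarith
      positivity
    linarith

lemma besselH_decay {β w : ℝ} (h0 : 1 / 2 ≤ β) (hw : 1 ≤ w) :
    (1 + β ^ 2 / w) * besselH β w * √w ≤ 22 := by
  have hw0 : 0 < w := by linarith
  -- Descend by n steps to an order in [1/2, 3/2), where the bound is 4. Passing from n² back to β²
  -- costs 11/2, whence 22.
  set n := ⌊β - 1 / 2⌋₊
  have hn1 : (n : ℝ) ≤ β - 1 / 2 := Nat.floor_le (by linarith)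
  have hn2 : β - 1 / 2 < n + 1 := Nat.lt_floor_add_one _
  have hn : (0 : ℝ) ≤ n := n.cast_nonneg
  have h1 := besselH_add_nat_le (β := β - n) (by linarith) hw0 n
  rw [sub_add_cancel] at h1
  have h2 := besselH_le_of_mem_Icc (β := β - n) (by linarith) (by linarith) hw0
  have hp := besselH_pos (show -(1 / 2) ≤ β by linarith) hw0
  have h3 : 1 + β ^ 2 / w ≤ 11 / 2 * (1 + (n : ℝ) ^ 2 / (2 * w)) := by
    have : β ^ 2 ≤ 2 * (n : ℝ) ^ 2 + 9 / 2 := by nlinarith [sq_nonneg ((n : ℝ) - 3 / 2)]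
    have e : 11 / 2 * (1 + (n : ℝ) ^ 2 / (2 * w)) - (1 + β ^ 2 / w) =
      (9 / 2 * w + 11 / 4 * (n : ℝ) ^ 2 - β ^ 2) / w := by field_simp; ring
    have : 0 ≤ (9 / 2 * w + 11 / 4 * (n : ℝ) ^ 2 - β ^ 2) / w :=
      div_nonneg (by nlinarith [sq_nonneg (n : ℝ)]) hw0.le
    linarith
  calc (1 + β ^ 2 / w) * besselH β w * √w
      ≤ 11 / 2 * (1 + (n : ℝ) ^ 2 / (2 * w)) * besselH β w * √w := by gcongr
    _ = 11 / 2 * ((1 + (n : ℝ) ^ 2 / (2 * w)) * besselH β w * √w) := by ring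
    _ ≤ 11 / 2 * (besselH (β - n) w * √w) := by gcongr
    _ ≤ 22 := by linarith

lemma hasDerivAt_besselH {β w : ℝ} (hβ : -(1 / 2) ≤ β) (hw : 0 < w) :
    HasDerivAt (besselH β) (besselH (β + 1) w - besselH β w + β / w * besselH β w) w := by
  have h1 : HasDerivAt (fun w : ℝ => (w / 2) ^ β) (1 / 2 * β * (w / 2) ^ (β - 1)) w :=
    ((hasDerivAt_id w).div_const 2).rpow_const (Or.inl (by simp; positivity))
  have h2 : HasDerivAt (fun w : ℝ => Real.exp (-w)) (Real.exp (-w) * -1) w :=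
    (hasDerivAt_neg w).exp
  have h3 : HasDerivAt (fun w : ℝ => besselE β (w ^ 2 / 4))
      (besselE (β + 1) (w ^ 2 / 4) * (2 * w / 4)) w := by
    have h4 : HasDerivAt (fun w : ℝ => w ^ 2 / 4) (2 * w / 4) w := by
      simpa using (hasDerivAt_pow 2 w).div_const 4
    exact (hasDerivAt_besselE hβ _).comp w h4
  refine ((h1.mul h2).mul h3).congr_deriv ?_
  rw [besselH_add_one β hw, besselH, Real.rpow_sub_one (by positivity)]
  simp only [Pi.mul_apply]
  field_simp
  ring

/-! ### Bounds that are uniform in the order -/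

/-- `w ^ (-α) e ^ (-w) I_{α+b}(w)`. -/
def conjBessel (α b w : ℝ) : ℝ := w ^ (-α) * besselH (α + b) w

/-- The derivative of `conjBessel α b`. -/
def conjBesselDeriv (α b w : ℝ) : ℝ :=
  w ^ (-α) * (besselH (α + b + 1) w - besselH (α + b) w + b / w * besselH (α + b) w)

lemma hasDerivAt_conjBessel {α b w : ℝ} (hb : -(1 / 2) ≤ α + b) (hw : 0 < w) :
    HasDerivAt (conjBessel α b) (conjBesselDeriv α b w) w := by
  have h1 : HasDerivAt (fun w : ℝ => w ^ (-α)) (-α * w ^ (-α - 1)) w :=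
    Real.hasDerivAt_rpow_const (Or.inl hw.ne')
  refine (h1.mul (hasDerivAt_besselH hb hw)).congr_deriv ?_
  rw [conjBesselDeriv, Real.rpow_sub_one hw.ne']
  field_simp
  ring

lemma continuousOn_besselH {β : ℝ} (hβ : -(1 / 2) ≤ β) :
    ContinuousOn (besselH β) (Set.Ioi 0) :=
  fun _ hw => (hasDerivAt_besselH hβ hw).continuousAt.continuousWithinAt

lemma continuousOn_conjBessel {α b : ℝ} (hb : -(1 / 2) ≤ α + b) :
    ContinuousOn (conjBessel α b) (Set.Ioi 0) :=
  fun _ hw => (hasDerivAt_conjBessel hb hw).continuousAt.continuousWithinAt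

lemma continuousOn_conjBesselDeriv {α b : ℝ} (hb : -(1 / 2) ≤ α + b) :
    ContinuousOn (conjBesselDeriv α b) (Set.Ioi 0) := by
  have h1 := continuousOn_besselH hb
  have h2 := continuousOn_besselH (show -(1 / 2) ≤ α + b + 1 by linarith)
  have h3 : ContinuousOn (fun w : ℝ => w ^ (-α)) (Set.Ioi 0) :=
    continuousOn_id.rpow_const fun w hw => Or.inl (ne_of_gt hw)
  have h4 : ContinuousOn (fun w : ℝ => b / w) (Set.Ioi 0) :=
    continuousOn_const.div continuousOn_id fun w hw => ne_of_gt hw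
  exact h3.mul ((h2.sub h1).add (h4.mul h1))

lemma besselE_le_four {β z : ℝ} (hβ : -(1 / 2) ≤ β) (h0 : 0 ≤ z) (h1 : z ≤ 1 / 4) :
    besselE β z ≤ 4 := by
  have hs : Summable fun m : ℕ => (1 / 4 : ℝ) ^ m :=
    summable_geometric_of_lt_one (by norm_num) (by norm_num)
  have h : besselE β z ≤ ∑' m : ℕ, 2 * (1 / 4 : ℝ) ^ m := by
    refine Summable.tsum_le_tsum (fun m => ?_) (summable_besselE hβ z) (hs.mul_left 2)
    have h2 : besselCoeff β m ≤ 2 := by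
      refine (besselCoeff_le hβ m).trans ?_
      have : (1 : ℝ) ≤ m.factorial := by exact_mod_cast m.factorial_pos
      have : 1 / (m.factorial : ℝ) ≤ 1 := by
        rw [div_le_one (by positivity)]; exact this
      linarith
    have := besselCoeff_pos hβ m
    gcongr
  rw [tsum_mul_left, tsum_geometric_of_lt_one (by norm_num) (by norm_num)] at h
  linarith

lemma conjBessel_le_of_le_one {α b w : ℝ} (hα : -(1 / 2) ≤ α) (hb : 0 ≤ b) (hw : 0 < w)
    (hw1 : w ≤ 1) : conjBessel α b w ≤ 8 * (w / 2) ^ b := by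
  have hE := besselE_le_four (show -(1 / 2) ≤ α + b by linarith)
    (show 0 ≤ w ^ 2 / 4 by positivity) (by nlinarith)
  have hEp := besselE_pos (show -(1 / 2) ≤ α + b by linarith) (show 0 ≤ w ^ 2 / 4 by positivity)
  have h2 : (1 / 2 : ℝ) ^ α ≤ 2 := by
    calc (1 / 2 : ℝ) ^ α ≤ (1 / 2) ^ (-1 : ℝ) :=
          Real.rpow_le_rpow_of_exponent_ge (by norm_num) (by norm_num) (by linarith)
      _ = 2 := by rw [Real.rpow_neg_one]; norm_num
  have e : w ^ (-α) * (w / 2) ^ (α + b) = (1 / 2) ^ α * (w / 2) ^ b := by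
    rw [Real.rpow_add (by positivity), div_eq_mul_one_div w 2, Real.mul_rpow hw.le (by norm_num),
      Real.rpow_neg hw.le]
    field_simp
  calc conjBessel α b w
      = (w ^ (-α) * (w / 2) ^ (α + b)) * (Real.exp (-w) * besselE (α + b) (w ^ 2 / 4)) := by
        rw [conjBessel, besselH]; ring
    _ ≤ (2 * (w / 2) ^ b) * (1 * 4) := by
        rw [e]
        gcongr
        rw [Real.exp_le_one_iff]; linarith
    _ = _ := by ring

lemma conjBessel_pos {α b w : ℝ} (hb : -(1 / 2) ≤ α + b) (hw : 0 < w) : 0 < conjBessel α b w :=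
  mul_pos (by positivity) (besselH_pos hb hw)

lemma conjBessel_succ (α b w : ℝ) :
    conjBessel α (b + 1) w = w ^ (-α) * besselH (α + b + 1) w := by
  rw [conjBessel, add_assoc]

lemma conjBesselDeriv_eq (α b w : ℝ) :
    conjBesselDeriv α b w =
      conjBessel α (b + 1) w - conjBessel α b w + b / w * conjBessel α b w := by
  rw [conjBesselDeriv, conjBessel_succ, conjBessel]; ring

/-- Near w = 0 the derivative contains b w^(b-1), unbounded for 0 < b < 1; hence the dichotomy on b.
For b ≥ 1 it is tamed by w^b ≤ w and b ≤ 2^b. -/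
lemma conjBessel_bounds_of_le_one {α b w : ℝ} (hα : -(1 / 2) ≤ α) (hb : b = 0 ∨ 1 ≤ b)
    (hw : 0 < w) (hw1 : w ≤ 1) :
    conjBessel α b w ≤ 8 ∧ |conjBessel α b w - conjBessel α (b + 1) w| ≤ 8 ∧
      |conjBesselDeriv α b w| ≤ 16 := by
  have hb0 : 0 ≤ b := by rcases hb with h | h <;> linarith
  have hp0 := conjBessel_pos (show -(1 / 2) ≤ α + b by linarith) hw
  have hp1 := conjBessel_pos (show -(1 / 2) ≤ α + (b + 1) by linarith) hw
  have h1 : ∀ c : ℝ, 0 ≤ c → conjBessel α c w ≤ 8 := fun c hc => by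
    have := conjBessel_le_of_le_one hα hc hw hw1
    have := Real.rpow_le_one (show 0 ≤ w / 2 by positivity) (by linarith) hc
    linarith
  have h2 : |conjBessel α b w - conjBessel α (b + 1) w| ≤ 8 := by
    rw [abs_le]; constructor <;> linarith [h1 b hb0, h1 (b + 1) (by linarith)]
  have h3 : 0 ≤ b / w * conjBessel α b w ∧ b / w * conjBessel α b w ≤ 8 := by
    refine ⟨by positivity, ?_⟩
    rcases hb with rfl | hb
    · simp
    · have h4 := conjBessel_le_of_le_one hα hb0 hw hw1
      have h6 : b * (w / 2) ^ b ≤ w := by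
        have h7 : b ≤ (2 : ℝ) ^ b := by
          have := one_add_mul_self_le_rpow_one_add (show (-1 : ℝ) ≤ 1 by norm_num) hb
          norm_num at this
          linarith
        have h8 : w ^ b ≤ w := by
          have := Real.rpow_le_rpow_of_exponent_ge hw hw1 hb
          rwa [Real.rpow_one] at this
        rw [Real.div_rpow hw.le (by norm_num), mul_div_assoc', div_le_iff₀ (by positivity)]
        have : 0 < w ^ b := by positivity
        nlinarith
      calc b / w * conjBessel α b w ≤ b / w * (8 * (w / 2) ^ b) := by gcongr
        _ = 8 * (b * (w / 2) ^ b) / w := by ring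
        _ ≤ 8 * w / w := by gcongr
        _ = 8 := by field_simp
  refine ⟨h1 b hb0, h2, ?_⟩
  rw [conjBesselDeriv_eq, abs_le]
  rw [abs_le] at h2
  constructor <;> linarith

/-- The difference costs a factor β + 1 ≤ 2(1 + β²/w)√w, which `besselH_decay` pays for. In the last
expression the terms of order β/w cancel: with q = β/w and (1 - q + q²)(1 + q) = 1 + q³ ≥ 1, what
remains lies between -H/w and q²H, where H = `besselH β w`. -/
lemma besselH_bounds_of_half_le {β w : ℝ} (h0 : 1 / 2 ≤ β) (hw : 1 ≤ w) :
    besselH β w * √w ≤ 22 ∧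
    0 ≤ besselH β w - besselH (β + 1) w ∧
    (besselH β w - besselH (β + 1) w) * w ≤ 44 ∧
    |besselH (β + 1) w - besselH β w + β / w * besselH β w| * (w * √w) ≤ 22 := by
  have hw0 : 0 < w := by linarith
  have hβ : -(1 / 2) ≤ β := by linarith
  have hd := besselH_decay h0 hw
  have hp := besselH_pos hβ hw0
  have hp1 := besselH_pos (show -(1 / 2) ≤ β + 1 by linarith) hw0
  have hs : √w * √w = w := Real.mul_self_sqrt hw0.le
  have hs1 : 1 ≤ √w := by rw [Real.one_le_sqrt]; exact hw
  have hβw : 0 ≤ β ^ 2 / w := by positivity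
  have h1 : besselH β w * √w ≤ 22 := by
    refine le_trans ?_ hd
    have : 0 < besselH β w * √w := by positivity
    nlinarith
  have h2 : besselH (β + 1) w ≤ besselH β w := besselH_succ_le (by linarith) hw0
  refine ⟨h1, by linarith, ?_, ?_⟩
  · have h3 := besselH_sub_succ_le hβ hw0
    have h4 : (β + 1) ≤ 2 * ((1 + β ^ 2 / w) * √w) := by
      have : β ≤ (1 + β ^ 2 / w) * √w := by
        have e : (1 + β ^ 2 / w) * √w = √w + (β / √w) ^ 2 * √w := by
          rw [div_pow, Real.sq_sqrt hw0.le]; ring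
        have e2 : β = (β / √w) * √w := by field_simp
        rw [e]
        nlinarith [sq_nonneg (β / √w - 1 / 2)]
      have : 1 ≤ (1 + β ^ 2 / w) * √w := by nlinarith
      linarith
    calc (besselH β w - besselH (β + 1) w) * w ≤ (β + 1) / w * besselH β w * w := by gcongr
      _ = (β + 1) * besselH β w := by field_simp
      _ ≤ 2 * ((1 + β ^ 2 / w) * √w) * besselH β w := by gcongr
      _ = 2 * ((1 + β ^ 2 / w) * besselH β w * √w) := by ring
      _ ≤ 44 := by linarith
  · have h3 := besselH_sub_succ_le hβ hw0
    have h5 := mul_besselH_succ_le hβ hw0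
    have hq : 0 ≤ β / w := by positivity
    have h6 : besselH (β + 1) w - besselH β w + β / w * besselH β w ≤
        (β / w) ^ 2 * besselH β w := by
      have h7 : (1 - β / w + (β / w) ^ 2) * ((1 + β / w) * besselH (β + 1) w) ≤
          (1 - β / w + (β / w) ^ 2) * besselH β w :=
        mul_le_mul_of_nonneg_left h5 (by nlinarith [sq_nonneg (β / w - 1)])
      have h8 : besselH (β + 1) w ≤ (1 - β / w + (β / w) ^ 2) * ((1 + β / w) *
          besselH (β + 1) w) := by
        have e : (1 - β / w + (β / w) ^ 2) * ((1 + β / w) * besselH (β + 1) w) =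
          (1 + (β / w) ^ 3) * besselH (β + 1) w := by ring
        rw [e]
        nlinarith [pow_nonneg hq 3]
      linarith
    have h9 : |besselH (β + 1) w - besselH β w + β / w * besselH β w| * w ≤
        (1 + β ^ 2 / w) * besselH β w := by
      rw [← abs_of_pos hw0, ← abs_mul, abs_of_pos hw0, abs_le]
      constructor
      · have e : (β + 1) / w * besselH β w = β / w * besselH β w + besselH β w / w := by ring
        have : -(besselH β w / w) ≤
            besselH (β + 1) w - besselH β w + β / w * besselH β w := by linarith
        have h10 := mul_le_mul_of_nonneg_right this hw0.le
        rw [neg_mul, div_mul_cancel₀ _ hw0.ne'] at h10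
        nlinarith
      · have h10 := mul_le_mul_of_nonneg_right h6 hw0.le
        have e : (β / w) ^ 2 * besselH β w * w = β ^ 2 / w * besselH β w := by field_simp
        linarith
    calc _ = (|besselH (β + 1) w - besselH β w + β / w * besselH β w| * w) * √w := by ring
      _ ≤ (1 + β ^ 2 / w) * besselH β w * √w := by gcongr
      _ ≤ 22 := hd

lemma besselH_bounds {α b w : ℝ} (hα : -(1 / 2) ≤ α) (hb : b = 0 ∨ 1 ≤ b) (hw : 1 ≤ w) :
    besselH (α + b) w * √w ≤ 88 * (1 + |α|) ∧
    |besselH (α + b) w - besselH (α + b + 1) w| * w ≤ 88 * (1 + |α|) ∧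
    |besselH (α + b + 1) w - besselH (α + b) w + b / w * besselH (α + b) w| * (w * √w) ≤
      88 * (1 + |α|) := by
  have hw0 : 0 < w := by linarith
  have hs : √w * √w = w := Real.mul_self_sqrt hw0.le
  have hs1 : 1 ≤ √w := by rw [Real.one_le_sqrt]; exact hw
  have ha := abs_nonneg α
  have hα1 := le_abs_self α
  rcases hb with rfl | hb
  -- For b = 0 the order α may lie below 1/2, so it is lifted to α + 1 and α + 2 by the recurrence.
  -- The price depends on α only.
  · have hr := besselH_recurrence hα hw0
    obtain ⟨h1, h2, h3, h4⟩ := besselH_bounds_of_half_le (show 1 / 2 ≤ α + 1 by linarith) hw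
    obtain ⟨h5, -, -, -⟩ := besselH_bounds_of_half_le (show 1 / 2 ≤ α + 2 by linarith) hw
    have hp := besselH_pos (show -(1 / 2) ≤ α + 1 by linarith) hw0
    rw [show α + 1 + 1 = α + 2 by ring] at h2 h3 h4
    rw [add_zero]
    have h6 : (α + 1) * besselH (α + 1) w * √w ≤ 22 * (1 + |α|) := by
      have : (α + 1) * (besselH (α + 1) w * √w) ≤ (α + 1) * 22 :=
        mul_le_mul_of_nonneg_left h1 (by linarith)
      nlinarith
    have h7 : (α + 1) * besselH (α + 1) w ≤ 22 * (1 + |α|) := by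
      refine le_trans ?_ h6
      have : 0 ≤ (α + 1) * besselH (α + 1) w := mul_nonneg (by linarith) hp.le
      nlinarith
    refine ⟨?_, ?_, ?_⟩
    · have : 2 * (α + 1) / w * besselH (α + 1) w * √w ≤
          2 * ((α + 1) * besselH (α + 1) w * √w) := by
        have h8 : 0 ≤ (α + 1) * besselH (α + 1) w * √w :=
          mul_nonneg (mul_nonneg (by linarith) hp.le) (by positivity)
        calc 2 * (α + 1) / w * besselH (α + 1) w * √w =
            (2 * ((α + 1) * besselH (α + 1) w * √w)) / w := by ring
          _ ≤ _ := div_le_self (by positivity) hw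
      rw [hr, add_mul]
      linarith
    · have e : (besselH α w - besselH (α + 1) w) * w =
          -((besselH (α + 1) w - besselH (α + 2) w) * w) + 2 * ((α + 1) * besselH (α + 1) w) := by
        rw [hr]; field_simp; ring
      rw [← abs_of_pos hw0, ← abs_mul, abs_of_pos hw0, e, abs_le]
      have : 0 ≤ (α + 1) * besselH (α + 1) w := mul_nonneg (by linarith) hp.le
      have : 0 ≤ (besselH (α + 1) w - besselH (α + 2) w) * w := by positivity
      constructor <;> linarith
    · have e : (besselH (α + 1) w - besselH α w + 0 / w * besselH α w) * (w * √w) =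
          -((besselH (α + 2) w - besselH (α + 1) w + (α + 1) / w * besselH (α + 1) w) * (w * √w)) -
            (α + 1) * besselH (α + 1) w * √w := by
        rw [hr]; field_simp; ring
      have hws : 0 < w * √w := by positivity
      have habs : ∀ X : ℝ, |X| * (w * √w) = |X * (w * √w)| := fun X => by
        rw [abs_mul, abs_of_pos hws]
      rw [habs] at h4 ⊢
      rw [e]
      have : 0 ≤ (α + 1) * besselH (α + 1) w * √w :=
        mul_nonneg (mul_nonneg (by linarith) hp.le) (by positivity)
      rw [abs_le] at h4 ⊢
      constructor <;> linarith
  · obtain ⟨h1, h2, h3, h4⟩ := besselH_bounds_of_half_le (show 1 / 2 ≤ α + b by linarith) hw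
    refine ⟨by linarith, ?_, ?_⟩
    · rw [abs_of_nonneg h2]; linarith
    · have hp := besselH_pos (show -(1 / 2) ≤ α + b by linarith) hw0
      have hws : 0 < w * √w := by positivity
      -- The derivative carries b/w instead of (α+b)/w; the discrepancy is α times a bounded
      -- quantity.
      have e : (besselH (α + b + 1) w - besselH (α + b) w + b / w * besselH (α + b) w) * (w * √w) =
        (besselH (α + b + 1) w - besselH (α + b) w + (α + b) / w * besselH (α + b) w) * (w * √w)
          - α * (besselH (α + b) w * √w) := by field_simp; ring
      have h5 : |α * (besselH (α + b) w * √w)| ≤ |α| * 22 := by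
        rw [abs_mul, abs_of_pos (show 0 < besselH (α + b) w * √w by positivity)]
        gcongr
      have habs : ∀ X : ℝ, |X| * (w * √w) = |X * (w * √w)| := fun X => by
        rw [abs_mul, abs_of_pos hws]
      rw [habs] at h4 ⊢
      rw [e]
      refine (abs_sub _ _).trans ?_
      linarith

/-- The weight that controls `conjBessel` uniformly in the order. -/
def besselWeight (α w : ℝ) : ℝ := (1 + w) ^ (-(α + 1 / 2))

lemma besselWeight_pos {α w : ℝ} (hw : 0 < w) : 0 < besselWeight α w := by
  unfold besselWeight; positivity

/-- All later estimates see the order b only through these three bounds. -/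
theorem conjBessel_bounds {α : ℝ} (hα : -(1 / 2) ≤ α) :
    ∃ C : ℝ, 0 < C ∧ ∀ b w : ℝ, (b = 0 ∨ 1 ≤ b) → 0 < w →
      conjBessel α b w ≤ C * besselWeight α w ∧
      |conjBessel α b w - conjBessel α (b + 1) w| * √(1 + w) ≤ C * besselWeight α w ∧
      |conjBesselDeriv α b w| * (1 + w) ≤ C * besselWeight α w := by
  have h2p : (0 : ℝ) < 2 ^ (α + 1 / 2) := by positivity
  -- The power of 2 compares 1 (for w ≤ 1) or w^(-α-1/2) (for w ≥ 1) with the weight; 352 = 4 · 88,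
  -- with 4 covering the passage from w to 1 + w.
  refine ⟨2 ^ (α + 1 / 2) * (352 * (1 + |α|)), by positivity, fun b w hb hw => ?_⟩
  have hp : 0 ≤ α + 1 / 2 := by linarith
  have ha := abs_nonneg α
  rcases le_total w 1 with hw1 | hw1
  · obtain ⟨h1, h2, h3⟩ := conjBessel_bounds_of_le_one hα hb hw hw1
    have hφ : 1 ≤ 2 ^ (α + 1 / 2) * besselWeight α w := by
      rw [besselWeight, Real.rpow_neg (by positivity), ← div_eq_mul_inv,
        one_le_div (by positivity)]
      exact Real.rpow_le_rpow (by positivity) (by linarith) hp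
    have hC : 352 ≤ 2 ^ (α + 1 / 2) * (352 * (1 + |α|)) * besselWeight α w := by
      have : 352 * (1 + |α|) * 1 ≤ 352 * (1 + |α|) * (2 ^ (α + 1 / 2) * besselWeight α w) := by
        gcongr
      linarith
    have hsq : √(1 + w) ≤ 2 := by
      rw [Real.sqrt_le_left (by norm_num)]; linarith
    refine ⟨by linarith, ?_, ?_⟩
    · calc _ ≤ 8 * (2 : ℝ) := by gcongr
        _ ≤ _ := by linarith
    · calc _ ≤ 16 * (2 : ℝ) := by gcongr; linarith
        _ ≤ _ := by linarith
  · obtain ⟨h1, h2, h3⟩ := besselH_bounds hα hb hw1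
    set M := 88 * (1 + |α|) with hM
    have hM0 : 0 < M := by positivity
    set g := w ^ (-(α + 1 / 2)) with hg
    have hg0 : 0 < g := by positivity
    have hgφ : g ≤ 2 ^ (α + 1 / 2) * besselWeight α w := by
      rw [hg, besselWeight, Real.rpow_neg hw.le, Real.rpow_neg (by positivity), ← div_eq_mul_inv,
        inv_eq_one_div, div_le_div_iff₀ (by positivity) (by positivity), one_mul,
        ← Real.mul_rpow (by norm_num) hw.le]
      exact Real.rpow_le_rpow (by positivity) (by linarith) hp
    have hwα : w ^ (-α) = g * √w := by
      rw [hg, Real.sqrt_eq_rpow, ← Real.rpow_add hw]; congr 1; ring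
    have hfin : ∀ X : ℝ, X ≤ 4 * M * g →
        X ≤ 2 ^ (α + 1 / 2) * (352 * (1 + |α|)) * besselWeight α w := fun X hX => by
      refine hX.trans ?_
      have : 4 * M * g ≤ 4 * M * (2 ^ (α + 1 / 2) * besselWeight α w) := by gcongr
      refine this.trans (le_of_eq ?_)
      rw [hM]; ring
    have hsq : √(1 + w) ≤ 2 * √w := by
      rw [Real.sqrt_le_left (by positivity), mul_pow, Real.sq_sqrt hw.le]; linarith
    have hs : √w * √w = w := Real.mul_self_sqrt hw.le
    refine ⟨hfin _ ?_, hfin _ ?_, hfin _ ?_⟩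
    · rw [conjBessel, hwα]
      calc g * √w * besselH (α + b) w = (besselH (α + b) w * √w) * g := by ring
        _ ≤ M * g := by gcongr
        _ ≤ 4 * M * g := by nlinarith
    · rw [conjBessel_succ, conjBessel, ← mul_sub, hwα, abs_mul, abs_of_pos (by positivity)]
      calc g * √w * |besselH (α + b) w - besselH (α + b + 1) w| * √(1 + w)
          ≤ g * √w * |besselH (α + b) w - besselH (α + b + 1) w| * (2 * √w) := by gcongr
        _ = 2 * g * (|besselH (α + b) w - besselH (α + b + 1) w| * (√w * √w)) := by ring
        _ ≤ 2 * g * M := by rw [hs]; gcongr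
        _ ≤ 4 * M * g := by nlinarith
    · rw [conjBesselDeriv, hwα, abs_mul, abs_of_pos (by positivity)]
      set Y := |besselH (α + b + 1) w - besselH (α + b) w + b / w * besselH (α + b) w|
      calc g * √w * Y * (1 + w) ≤ g * √w * Y * (2 * w) := by gcongr; linarith
        _ = 2 * g * (Y * (w * √w)) := by ring
        _ ≤ 2 * g * M := by gcongr
        _ ≤ 4 * M * g := by nlinarith

/-! ### Tools for power series and double series -/

lemma hasSum_of_eq {ι : Type*} {f g : ι → ℝ} {a b : ℝ} (h : HasSum f a) (hfg : ∀ i, g i = f i)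
    (hab : b = a) : HasSum g b := by
  rw [hab, funext hfg]; exact h

lemma coeff_eq_of_hasSum_eq {a b : ℕ → ℝ} {f : ℝ → ℝ} {ε : ℝ} (hε : 0 < ε)
    (ha : ∀ h : ℝ, |h| < ε → HasSum (fun i => h ^ i * a i) (f h))
    (hb : ∀ h : ℝ, |h| < ε → HasSum (fun i => h ^ i * b i) (f h)) : a = b := by
  have key : ∀ c : ℕ → ℝ, (∀ h : ℝ, |h| < ε → HasSum (fun i => h ^ i * c i) (f h)) →
      HasFPowerSeriesAt f (FormalMultilinearSeries.ofScalars ℝ c) 0 := fun c hc => by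
    rw [hasFPowerSeriesAt_iff]
    have : Metric.ball (0 : ℝ) ε ∈ 𝓝 (0 : ℝ) := Metric.ball_mem_nhds _ hε
    filter_upwards [this] with h hh
    simpa [FormalMultilinearSeries.coeff_ofScalars] using hc h (by simpa using hh)
  have := (key a ha).eq_formalMultilinearSeries (key b hb)
  exact FormalMultilinearSeries.ofScalars_series_injective ℝ ℝ this

lemma hasSum_sum_range_of_summable {f : ℕ × ℕ → ℝ} (hf : Summable f) :
    HasSum (fun k => ∑ i ∈ Finset.range (k + 1), f (i, k - i)) (∑' p, f p) := by
  have h1 := (Finset.HasAntidiagonal.sigmaAntidiagonalEquivProd (A := ℕ)).hasSum_iff.2 hf.hasSum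
  have h2 := h1.sigma (g := fun k => ∑ i ∈ Finset.range (k + 1), f (i, k - i)) fun k => by
    have := hasSum_fintype (fun p : Finset.HasAntidiagonal.antidiagonal k => f p)
    rw [Finset.sum_coe_sort (Finset.HasAntidiagonal.antidiagonal k) f,
      Finset.Nat.sum_antidiagonal_eq_sum_range_succ_mk] at this
    exact this
  exact h2

lemma Gamma_add_nat {s : ℝ} (hs : 0 < s) (n : ℕ) :
    Real.Gamma (n + s) = (ascPochhammer ℝ n).eval s * Real.Gamma s := by
  induction n with
  | zero => simp
  | succ n ih =>
    have : (0 : ℝ) < n + s := by positivity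
    rw [ascPochhammer_succ_eval, Nat.cast_add_one, show (n : ℝ) + 1 + s = n + s + 1 by ring,
      Real.Gamma_add_one this.ne', ih]
    ring

lemma hasSum_binomial_neg {s r : ℝ} (hs : 0 < s) (hr : |r| < 1) :
    HasSum (fun n : ℕ => Real.Gamma (n + s) / (Real.Gamma s * n.factorial) * r ^ n)
      ((1 - r) ^ (-s)) := by
  have h := (Real.one_div_one_sub_rpow_hasFPowerSeriesOnBall_zero s).hasSum (y := r)
    (by simpa [enorm_eq_nnnorm, ← NNReal.coe_lt_coe] using hr)
  simp only [FormalMultilinearSeries.ofScalars_apply_eq, zero_add, smul_eq_mul] at h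
  rw [Real.rpow_neg (by linarith [(abs_lt.1 hr).2]), inv_eq_one_div]
  refine h.congr_fun fun n => ?_
  rw [← Ring.multichoose_eq]
  have h2 := Ring.factorial_nsmul_multichoose_eq_ascPochhammer s n
  rw [Polynomial.ascPochhammer_smeval_eq_eval, nsmul_eq_mul] at h2
  rw [Gamma_add_nat hs, ← h2]
  have := Real.Gamma_pos_of_pos hs
  field_simp

/-! ### The generating function of the Laguerre polynomials -/

/-- The general term of the double series whose antidiagonal sums are `r ^ k * L_k^β(v)`. -/
def laguerreDouble (β r v : ℝ) (p : ℕ × ℕ) : ℝ :=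
  r ^ (p.1 + p.2) * (Real.Gamma (((p.1 + p.2 : ℕ) : ℝ) + β + 1) / Real.Gamma ((p.1 : ℝ) + β + 1) *
    ((-v) ^ p.1 / ((p.1.factorial : ℝ) * (p.2.factorial : ℝ))))

lemma Gamma_cast_pos {β : ℝ} (hβ : -(1 / 2) ≤ β) (k : ℕ) : 0 < Real.Gamma ((k : ℝ) + β + 1) :=
  Real.Gamma_pos_of_pos (by linarith [k.cast_nonneg (α := ℝ)])

lemma hasSum_laguerreDouble_snd {β r : ℝ} (hβ : -(1 / 2) ≤ β) (v : ℝ) (hr : |r| < 1) (l : ℕ) :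
    HasSum (fun n => laguerreDouble β r v (l, n))
      ((1 - r) ^ (-(β + 1)) * ((-(v * r / (1 - r))) ^ l / l.factorial)) := by
  have h1 : 0 < 1 - r := by linarith [(abs_lt.1 hr).2]
  have h := (hasSum_binomial_neg (s := (l : ℝ) + β + 1)
    (by linarith [l.cast_nonneg (α := ℝ)]) hr).mul_left (r ^ l * (-v) ^ l / l.factorial)
  refine hasSum_of_eq h (fun n => ?_) ?_
  · have := Gamma_cast_pos hβ l
    simp only [laguerreDouble]
    rw [pow_add, show ((l + n : ℕ) : ℝ) + β + 1 = n + (l + β + 1) by push_cast; ring]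
    field_simp
  · rw [show -((l : ℝ) + β + 1) = -(β + 1) - l by ring, Real.rpow_sub_natCast h1.ne',
      show -(v * r / (1 - r)) = r * (-v) / (1 - r) by ring, div_pow, mul_pow]
    field_simp

/-- Absolute values amount to a change of parameters, so absolute summability follows from the
evaluated iterated sums. -/
lemma abs_laguerreDouble {β : ℝ} (hβ : -(1 / 2) ≤ β) (r v : ℝ) (p : ℕ × ℕ) :
    |laguerreDouble β r v p| = laguerreDouble β |r| (-|v|) p := by
  have h1 := Gamma_cast_pos hβ (p.1 + p.2)
  have h2 := Gamma_cast_pos hβ p.1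
  rw [laguerreDouble, laguerreDouble, abs_mul, abs_mul, abs_div, abs_div, abs_pow, abs_pow,
    abs_neg, neg_neg, abs_of_pos h1, abs_of_pos h2, abs_mul, Nat.abs_cast, Nat.abs_cast]

lemma hasSum_exp_scaled (c q : ℝ) :
    HasSum (fun l : ℕ => c * (q ^ l / l.factorial)) (c * Real.exp q) := by
  rw [Real.exp_eq_exp_ℝ]
  exact (NormedSpace.expSeries_div_hasSum_exp q).mul_left c

lemma summable_laguerreDouble {β r : ℝ} (hβ : -(1 / 2) ≤ β) (v : ℝ) (hr : |r| < 1) :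
    Summable (laguerreDouble β r v) := by
  rw [← summable_abs_iff]
  simp only [abs_laguerreDouble hβ]
  have hr' : |(|r|)| < 1 := by rwa [abs_abs]
  rw [summable_prod_of_nonneg fun p => by
    rw [Pi.zero_apply, ← abs_laguerreDouble hβ]; exact abs_nonneg _]
  refine ⟨fun l => (hasSum_laguerreDouble_snd hβ _ hr' l).summable, ?_⟩
  simp only [(hasSum_laguerreDouble_snd hβ _ hr' _).tsum_eq]
  exact (hasSum_exp_scaled _ _).summable

theorem hasSum_laguerrePoly {β r : ℝ} (hβ : -(1 / 2) ≤ β) (v : ℝ) (hr : |r| < 1) :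
    HasSum (fun k => r ^ k * laguerrePoly β k v)
      ((1 - r) ^ (-(β + 1)) * Real.exp (-(v * r / (1 - r)))) := by
  have hs := summable_laguerreDouble hβ v hr
  have h1 := hs.hasSum.prod_fiberwise fun l => hasSum_laguerreDouble_snd hβ v hr l
  rw [← (h1.unique (hasSum_exp_scaled _ _))]
  refine (hasSum_sum_range_of_summable hs).congr_fun fun k => ?_
  rw [laguerrePoly, Finset.mul_sum]
  refine Finset.sum_congr rfl fun i hi => ?_
  rw [laguerreDouble, Nat.add_sub_cancel' (Nat.lt_succ_iff.1 (Finset.mem_range.1 hi))]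

lemma abs_laguerrePoly_le {β : ℝ} (hβ : -(1 / 2) ≤ β) (k : ℕ) (v : ℝ) :
    |laguerrePoly β k v| ≤ laguerrePoly β k (-|v|) := by
  refine (Finset.abs_sum_le_sum_abs _ _).trans (le_of_eq (Finset.sum_congr rfl fun i _ => ?_))
  have h1 := Gamma_cast_pos hβ k
  have h2 := Gamma_cast_pos hβ i
  rw [abs_mul, abs_div, abs_div, abs_pow, abs_neg, neg_neg, abs_of_pos h1, abs_of_pos h2, abs_mul,
    Nat.abs_cast, Nat.abs_cast]

lemma hasSum_add_pow_choose (r h : ℝ) (k : ℕ) :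
    HasSum (fun i => (k.choose i : ℝ) * r ^ (k - i) * h ^ i) ((r + h) ^ k) := by
  rw [add_comm r h, add_pow]
  have : ∑ i ∈ Finset.range (k + 1), h ^ i * r ^ (k - i) * (k.choose i : ℝ) =
      ∑ i ∈ Finset.range (k + 1), (k.choose i : ℝ) * r ^ (k - i) * h ^ i :=
    Finset.sum_congr rfl fun i _ => by ring
  rw [this]
  refine hasSum_sum_of_ne_finset_zero fun i hi => ?_
  rw [Nat.choose_eq_zero_of_lt (by simpa using hi)]
  simp

/-- The double series obtained by expanding the generating function at `r + h` in powers of `h`. -/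
lemma summable_choose_laguerrePoly {β r h : ℝ} (hβ : -(1 / 2) ≤ β) (v : ℝ) (hr : 0 < r)
    (hrh : r + |h| < 1) :
    Summable fun p : ℕ × ℕ =>
      (p.1.choose p.2 : ℝ) * r ^ (p.1 - p.2) * h ^ p.2 * laguerrePoly β p.1 v := by
  have hrh' : |r + (|h|)| < 1 := by rwa [abs_of_pos (by positivity)]
  rw [← summable_abs_iff, summable_prod_of_nonneg fun p => abs_nonneg _]
  have key : ∀ k : ℕ, HasSum (fun i => |(k.choose i : ℝ) * r ^ (k - i) * h ^ i *
      laguerrePoly β k v|) ((r + |h|) ^ k * |laguerrePoly β k v|) := fun k => by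
    refine ((hasSum_add_pow_choose r |h| k).mul_right |laguerrePoly β k v|).congr_fun fun i => ?_
    rw [abs_mul, abs_mul, abs_mul, Nat.abs_cast, abs_pow, abs_pow, abs_of_pos hr]
  refine ⟨fun k => (key k).summable, ?_⟩
  simp only [(key _).tsum_eq]
  refine Summable.of_nonneg_of_le (fun k => by positivity) (fun k => ?_)
    (hasSum_laguerrePoly hβ (-|v|) hrh').summable
  gcongr
  exact abs_laguerrePoly_le hβ k v

/-- The generating function at r + h is expanded in h twice: by the binomial theorem in each (r +
h)^k, and by recognising it as a multiple of the generating function at h/(1-r) with argument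
v/(1-r). Comparing the coefficients of h^i gives the sum. -/
theorem hasSum_choose_laguerrePoly {β r : ℝ} (hβ : -(1 / 2) ≤ β) (v : ℝ) (hr : 0 < r)
    (hr1 : r < 1) (i : ℕ) :
    HasSum (fun k => (k.choose i : ℝ) * r ^ (k - i) * laguerrePoly β k v)
      ((1 - r) ^ (-(β + 1)) * Real.exp (-(v * r / (1 - r))) *
        ((1 - r)⁻¹ ^ i * laguerrePoly β i (v / (1 - r)))) := by
  have h1r : 0 < 1 - r := by linarith
  have hsum : ∀ i : ℕ, Summable fun k : ℕ =>
      (k.choose i : ℝ) * r ^ (k - i) * laguerrePoly β k v := fun i => by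
    have hp : 0 < (1 - r) / 2 := by linarith
    have h := (summable_choose_laguerrePoly (h := (1 - r) / 2) hβ v hr
      (by rw [abs_of_pos hp]; linarith)).prod_symm.prod_factor i
    refine (h.mul_left ((((1 - r) / 2) ^ i)⁻¹)).congr fun k => ?_
    simp only [Prod.swap_prod_mk]
    field_simp
  have hEq := coeff_eq_of_hasSum_eq h1r
    (a := fun i => ∑' k : ℕ, (k.choose i : ℝ) * r ^ (k - i) * laguerrePoly β k v)
    (b := fun i => (1 - r) ^ (-(β + 1)) * Real.exp (-(v * r / (1 - r))) *
        ((1 - r)⁻¹ ^ i * laguerrePoly β i (v / (1 - r))))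
    (f := fun h => (1 - (r + h)) ^ (-(β + 1)) * Real.exp (-(v * (r + h) / (1 - (r + h)))))
    (fun h hh => ?_) (fun h hh => ?_)
  · have := congrFun hEq i
    beta_reduce at this
    rw [← this]
    exact (hsum i).hasSum
  · have hs := summable_choose_laguerrePoly (h := h) hβ v hr (by linarith)
    have hrh : |r + h| < 1 := by
      refine (abs_add_le _ _).trans_lt ?_
      rw [abs_of_pos hr]; linarith
    have e1 := hs.hasSum.prod_fiberwise fun k =>
      (hasSum_add_pow_choose r h k).mul_right (laguerrePoly β k v)
    rw [← e1.unique (hasSum_laguerrePoly hβ v hrh)]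
    have e2 := (hs.prod_symm.hasSum).prod_fiberwise fun i => (hs.prod_symm.prod_factor i).hasSum
    have e3 : ∑' p : ℕ × ℕ, ((p.swap.1.choose p.swap.2 : ℝ) * r ^ (p.swap.1 - p.swap.2) *
        h ^ p.swap.2 * laguerrePoly β p.swap.1 v) = ∑' p : ℕ × ℕ,
        ((p.1.choose p.2 : ℝ) * r ^ (p.1 - p.2) * h ^ p.2 * laguerrePoly β p.1 v) :=
      (Equiv.prodComm ℕ ℕ).tsum_eq fun p : ℕ × ℕ =>
        (p.1.choose p.2 : ℝ) * r ^ (p.1 - p.2) * h ^ p.2 * laguerrePoly β p.1 v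
    rw [e3] at e2
    refine e2.congr_fun fun i => ?_
    rw [← tsum_mul_left]
    refine tsum_congr fun k => ?_
    simp only [Prod.swap_prod_mk]
    ring
  · have hh' := abs_lt.1 hh
    have hq : |h / (1 - r)| < 1 := by
      rw [abs_div, abs_of_pos h1r, div_lt_one h1r]; exact hh
    have hA : 0 < 1 - (r + h) := by linarith
    have e := (hasSum_laguerrePoly hβ (v / (1 - r)) hq).mul_left
      ((1 - r) ^ (-(β + 1)) * Real.exp (-(v * r / (1 - r))))
    have hB : 1 - h / (1 - r) = (1 - (r + h)) / (1 - r) := by field_simp; ring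
    refine hasSum_of_eq e (fun k => ?_) ?_
    · rw [div_pow, inv_pow]
      ring
    · rw [hB, Real.div_rpow hA.le h1r.le,
        mul_mul_mul_comm, mul_div_cancel₀ _ (by positivity), ← Real.exp_add]
      congr 2
      field_simp
      ring

/-- Dividing by Γ(i + β + 1) turns the left side into the Cauchy product of the series of `besselE`
and of the exponential. -/
theorem hasSum_laguerrePoly_div_Gamma {β : ℝ} (hβ : -(1 / 2) ≤ β) (τ V : ℝ) :
    HasSum (fun i : ℕ => τ ^ i * laguerrePoly β i V / Real.Gamma ((i : ℝ) + β + 1))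
      (Real.exp τ * besselE β (-(τ * V))) := by
  have h1 : Summable fun n : ℕ => ‖besselCoeff β n * (-(τ * V)) ^ n‖ :=
    (summable_besselE hβ _).norm
  have h2 : Summable fun n : ℕ => ‖τ ^ n / n.factorial‖ := (Real.summable_pow_div_factorial τ).norm
  have h := hasSum_sum_range_mul_of_summable_norm h1 h2
  have e : ∑' n : ℕ, τ ^ n / n.factorial = Real.exp τ := by
    rw [Real.exp_eq_exp_ℝ]
    exact (NormedSpace.expSeries_div_hasSum_exp τ).tsum_eq
  rw [e] at h
  refine hasSum_of_eq h (fun i => ?_) (mul_comm _ _)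
  rw [laguerrePoly, Finset.mul_sum, Finset.sum_div]
  refine Finset.sum_congr rfl fun l hl => ?_
  have hli : l ≤ i := Nat.lt_succ_iff.1 (Finset.mem_range.1 hl)
  have g1 := Gamma_cast_pos hβ i
  have g2 := Gamma_cast_pos hβ l
  obtain ⟨n, rfl⟩ := Nat.exists_eq_add_of_le hli
  rw [Nat.add_sub_cancel_left, besselCoeff, show -(τ * V) = τ * (-V) by ring, mul_pow, pow_add]
  field_simp

/-! ### The Hille–Hardy formula -/

/-- The general term of the double series that is summed in two ways in the Hille–Hardy formula. -/
def hilleHardyTerm (β r u v : ℝ) (p : ℕ × ℕ) : ℝ :=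
  r ^ p.1 * laguerrePoly β p.1 v *
    ((p.1.choose p.2 : ℝ) * ((-u) ^ p.2 / Real.Gamma ((p.2 : ℝ) + β + 1)))

lemma hasSum_hilleHardyTerm_fst {β r : ℝ} (hβ : -(1 / 2) ≤ β) (u v : ℝ) (hr : 0 < r)
    (hr1 : r < 1) (i : ℕ) :
    HasSum (fun k => hilleHardyTerm β r u v (k, i))
      ((1 - r) ^ (-(β + 1)) * Real.exp (-(v * r / (1 - r))) *
        ((-(u * r / (1 - r))) ^ i * laguerrePoly β i (v / (1 - r)) /
          Real.Gamma ((i : ℝ) + β + 1))) := by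
  refine hasSum_of_eq ((hasSum_choose_laguerrePoly hβ v hr hr1 i).mul_left
    (r ^ i * (-u) ^ i / Real.Gamma ((i : ℝ) + β + 1))) (fun k => ?_) ?_
  · rw [hilleHardyTerm]
    rcases le_or_gt i k with h | h
    · have : r ^ k = r ^ i * r ^ (k - i) := by rw [← pow_add, Nat.add_sub_cancel' h]
      simp only [this]
      ring
    · simp [Nat.choose_eq_zero_of_lt h]
  · rw [show -(u * r / (1 - r)) = r * (-u) * (1 - r)⁻¹ by ring, mul_pow, mul_pow]
    ring

lemma hasSum_hilleHardyTerm_snd {β : ℝ} (hβ : -(1 / 2) ≤ β) (r u v : ℝ) (k : ℕ) :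
    HasSum (fun i => hilleHardyTerm β r u v (k, i))
      (r ^ k * ((k.factorial : ℝ) / Real.Gamma ((k : ℝ) + β + 1)) *
        laguerrePoly β k u * laguerrePoly β k v) := by
  have h := hasSum_sum_of_ne_finset_zero (L := .unconditional ℕ) (f := fun i => hilleHardyTerm β r u v (k, i))
    (s := Finset.range (k + 1)) fun i hi => by
      rw [hilleHardyTerm, Nat.choose_eq_zero_of_lt (by simpa using hi)]
      simp
  refine hasSum_of_eq h (fun _ => rfl) ?_
  have hk := Gamma_cast_pos hβ k
  simp only [hilleHardyTerm]
  generalize laguerrePoly β k v = Lv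
  rw [laguerrePoly, Finset.mul_sum, Finset.sum_mul]
  refine Finset.sum_congr rfl fun i hi => ?_
  have hik : i ≤ k := Nat.lt_succ_iff.1 (Finset.mem_range.1 hi)
  have hi := Gamma_cast_pos hβ i
  rw [Nat.cast_choose ℝ hik]
  field_simp

lemma summable_hilleHardyTerm {β r : ℝ} (hβ : -(1 / 2) ≤ β) (u v : ℝ) (hr : 0 < r)
    (hr1 : r < 1) : Summable (hilleHardyTerm β r u v) := by
  have hle : ∀ p, |hilleHardyTerm β r u v p| ≤ hilleHardyTerm β r (-|u|) (-|v|) p := fun p => by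
    have h1 := Gamma_cast_pos hβ p.2
    rw [hilleHardyTerm, hilleHardyTerm, abs_mul, abs_mul, abs_mul, abs_div, abs_pow, abs_pow,
      abs_neg, neg_neg, Nat.abs_cast, abs_of_pos h1, abs_of_pos hr]
    gcongr
    exact abs_laguerrePoly_le hβ _ _
  have hnn : ∀ p, 0 ≤ hilleHardyTerm β r (-|u|) (-|v|) p := fun p => (abs_nonneg _).trans (hle p)
  refine Summable.of_norm_bounded (g := hilleHardyTerm β r (-|u|) (-|v|)) ?_ hle
  rw [← (Equiv.prodComm ℕ ℕ).summable_iff, summable_prod_of_nonneg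
    (f := hilleHardyTerm β r (-|u|) (-|v|) ∘ ⇑(Equiv.prodComm ℕ ℕ)) fun p => hnn _]
  have key := hasSum_hilleHardyTerm_fst hβ (-|u|) (-|v|) hr hr1
  refine ⟨fun i => (key i).summable, ?_⟩
  have e : (fun i => ∑' k, (hilleHardyTerm β r (-|u|) (-|v|) ∘ ⇑(Equiv.prodComm ℕ ℕ)) (i, k)) =
      _ := funext fun i => (key i).tsum_eq
  rw [e]
  exact (hasSum_laguerrePoly_div_Gamma hβ _ _).summable.mul_left _

/-- The Hille–Hardy formula. -/
theorem hasSum_hilleHardy {β r : ℝ} (hβ : -(1 / 2) ≤ β) (u v : ℝ) (hr : 0 < r) (hr1 : r < 1) :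
    HasSum (fun k : ℕ => r ^ k * ((k.factorial : ℝ) / Real.Gamma ((k : ℝ) + β + 1)) *
        laguerrePoly β k u * laguerrePoly β k v)
      ((1 - r) ^ (-(β + 1)) * Real.exp (-((u + v) * (r / (1 - r)))) *
        besselE β (u * v * r / (1 - r) ^ 2)) := by
  have h1r : 0 < 1 - r := by linarith
  have hs := summable_hilleHardyTerm hβ u v hr hr1
  -- Summing over i first rebuilds the polynomial in u; summing over k first produces Laguerre
  -- polynomials at v/(1-r), whose sum over i is the Bessel series.
  have e1 := hs.hasSum.prod_fiberwise (hasSum_hilleHardyTerm_snd hβ r u v)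
  have e2 := ((Equiv.prodComm ℕ ℕ).hasSum_iff.2 hs.hasSum).prod_fiberwise
    (hasSum_hilleHardyTerm_fst hβ u v hr hr1)
  refine hasSum_of_eq e1 (fun _ => rfl) (Eq.symm (e2.unique (hasSum_of_eq
    ((hasSum_laguerrePoly_div_Gamma hβ (-(u * r / (1 - r))) (v / (1 - r))).mul_left
      ((1 - r) ^ (-(β + 1)) * Real.exp (-(v * r / (1 - r)))))
    (fun _ => rfl) ?_)))
  have e3 : Real.exp (-((u + v) * (r / (1 - r)))) =
      Real.exp (-(v * r / (1 - r))) * Real.exp (-(u * r / (1 - r))) := by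
    rw [← Real.exp_add]; congr 1; ring
  have e4 : -(-(u * r / (1 - r)) * (v / (1 - r))) = u * v * r / (1 - r) ^ 2 := by
    field_simp
  rw [e3, e4]
  ring

/-! ### The closed form of the heat kernel -/

/-- The closed form of the heat kernel. -/
def heatClosed (β t x y : ℝ) : ℝ :=
  2 * (2 * Real.sinh (2 * t))⁻¹ ^ (β + 1) *
    Real.exp (-(Real.cosh (2 * t) / Real.sinh (2 * t) * (x ^ 2 + y ^ 2) / 2)) *
    besselE β ((x * y * (2 * Real.sinh (2 * t))⁻¹) ^ 2)

theorem hasSum_heatTerm {β t : ℝ} (hβ : -(1 / 2) ≤ β) (ht : 0 < t) (x y : ℝ) :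
    HasSum (heatTerm β t x y) (heatClosed β t x y) := by
  -- With q = √r = e^(-2t), the eigenvalue factor is q^(β+1) r^k.
  set r := Real.exp (-(4 * t)) with hr
  have hr0 : 0 < r := Real.exp_pos _
  have hr1 : r < 1 := by rw [hr, Real.exp_lt_one_iff]; linarith
  have h1r : 0 < 1 - r := by linarith
  set q := Real.exp (-(2 * t)) with hq
  have hq0 : 0 < q := Real.exp_pos _
  have hrq : r = q ^ 2 := by rw [hr, hq, ← Real.exp_nat_mul]; congr 1; push_cast; ring
  have hqi : Real.exp (2 * t) = q⁻¹ := by rw [hq, ← Real.exp_neg, neg_neg]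
  have hsinh : Real.sinh (2 * t) = (1 - r) / (2 * q) := by
    rw [Real.sinh_eq, ← hq, hqi, hrq]; field_simp
  have hcosh : Real.cosh (2 * t) = (1 + r) / (2 * q) := by
    rw [Real.cosh_eq, ← hq, hqi, hrq]; field_simp
  have hσ : (2 * Real.sinh (2 * t))⁻¹ = q / (1 - r) := by rw [hsinh]; field_simp
  have h := (hasSum_hilleHardy hβ (x ^ 2) (y ^ 2) hr0 hr1).mul_left
    (2 * q ^ (β + 1) * Real.exp (-((x ^ 2 + y ^ 2) / 2)))
  refine hasSum_of_eq h (fun k => ?_) ?_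
  · have hk := Gamma_cast_pos hβ k
    have e1 : Real.exp (-(t * (4 * (k : ℝ) + 2 * β + 2))) = q ^ (β + 1) * r ^ k := by
      rw [hr, hq, ← Real.exp_mul, ← Real.exp_nat_mul, ← Real.exp_add]
      congr 1; ring
    have e2 : Real.exp (-((x ^ 2 + y ^ 2) / 2)) =
        Real.exp (-x ^ 2 / 2) * Real.exp (-y ^ 2 / 2) := by
      rw [← Real.exp_add]; congr 1; ring
    have e3 : √(2 * Real.Gamma ((k : ℝ) + 1) / Real.Gamma ((k : ℝ) + β + 1)) *
        √(2 * Real.Gamma ((k : ℝ) + 1) / Real.Gamma ((k : ℝ) + β + 1)) =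
        2 * ((k.factorial : ℝ) / Real.Gamma ((k : ℝ) + β + 1)) := by
      rw [Real.mul_self_sqrt (by rw [Real.Gamma_nat_eq_factorial]; positivity),
        Real.Gamma_nat_eq_factorial]
      ring
    rw [heatTerm, laguerreFun, laguerreFun, e1, e2]
    linear_combination (q ^ (β + 1) * r ^ k * laguerrePoly β k (x ^ 2) * laguerrePoly β k (y ^ 2) *
      (Real.exp (-x ^ 2 / 2) * Real.exp (-y ^ 2 / 2))) * e3
  · rw [heatClosed, hσ, hcosh, hsinh, Real.div_rpow hq0.le h1r.le, Real.rpow_neg h1r.le]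
    have e1 : Real.exp (-((1 + r) / (2 * q) / ((1 - r) / (2 * q)) * (x ^ 2 + y ^ 2) / 2)) =
        Real.exp (-((x ^ 2 + y ^ 2) / 2)) * Real.exp (-((x ^ 2 + y ^ 2) * (r / (1 - r)))) := by
      rw [← Real.exp_add]; congr 1; field_simp; ring
    have e2 : (x * y * (q / (1 - r))) ^ 2 = x ^ 2 * y ^ 2 * r / (1 - r) ^ 2 := by
      rw [hrq]; field_simp
    rw [e1, e2]
    ring

theorem heatKernel_eq {β t : ℝ} (hβ : -(1 / 2) ≤ β) (ht : 0 < t) (x y : ℝ) :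
    heatKernel β t x y = heatClosed β t x y :=
  (hasSum_heatTerm hβ ht x y).tsum_eq

/-! ### The kernel under the integral sign -/

/-- `exp (-(cosh 2t / sinh 2t) (x² + y²) / 2 + x y / sinh 2t)`. -/
def mehlerExp (t x y : ℝ) : ℝ :=
  Real.exp (-((Real.tanh t * (x + y) ^ 2 + (x - y) ^ 2 / Real.tanh t) / 4))

/-- The non-exponential factor of `conjIntegrand`. -/
def conjBracket (α b t x y : ℝ) : ℝ :=
  (Real.sinh (2 * t))⁻¹ * (y * conjBessel α (b + 1) (x * y * (Real.sinh (2 * t))⁻¹) -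
      x * conjBessel α b (x * y * (Real.sinh (2 * t))⁻¹)) +
    (1 - Real.tanh t) * (x * conjBessel α b (x * y * (Real.sinh (2 * t))⁻¹))

/-- The function `(xy) ^ b δ_{α+b} G_{α+b,t}(x,y)`. -/
def conjIntegrand (α b t x y : ℝ) : ℝ :=
  (Real.sinh (2 * t))⁻¹ ^ (α + 1) * (mehlerExp t x y * conjBracket α b t x y)

lemma sinh_two_mul_pos {t : ℝ} (ht : 0 < t) : 0 < Real.sinh (2 * t) :=
  Real.sinh_pos_iff.2 (by linarith)

lemma tanh_pos_of_pos {t : ℝ} (ht : 0 < t) : 0 < Real.tanh t := by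
  rw [Real.tanh_eq_sinh_div_cosh]
  exact div_pos (Real.sinh_pos_iff.2 ht) (Real.cosh_pos t)

lemma cosh_two_mul_div {t : ℝ} (ht : 0 < t) :
    Real.cosh (2 * t) / Real.sinh (2 * t) = (Real.sinh (2 * t))⁻¹ + Real.tanh t := by
  have h1 := Real.sinh_pos_iff.2 ht
  have h2 := Real.cosh_pos t
  have h3 := Real.cosh_sq t
  rw [Real.tanh_eq_sinh_div_cosh, Real.cosh_two_mul, Real.sinh_two_mul]
  field_simp
  rw [h3]
  ring

lemma inv_sinh_two_mul {t : ℝ} (ht : 0 < t) :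
    (Real.sinh (2 * t))⁻¹ = ((Real.tanh t)⁻¹ - Real.tanh t) / 2 := by
  have h1 := Real.sinh_pos_iff.2 ht
  have h2 := Real.cosh_pos t
  have h3 := Real.cosh_sq t
  rw [Real.tanh_eq_sinh_div_cosh, Real.sinh_two_mul]
  field_simp
  rw [h3]
  ring

/-- With T = tanh t, one has T + 1/T = 2 coth 2t and 1/T - T = 2/sinh 2t. The factor e^(-w) split
off here is the scaling in `besselH`. -/
lemma exp_eq_mehlerExp {t : ℝ} (ht : 0 < t) (x y : ℝ) :
    Real.exp (-(Real.cosh (2 * t) / Real.sinh (2 * t) * (x ^ 2 + y ^ 2) / 2)) =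
      mehlerExp t x y * Real.exp (-(x * y * (Real.sinh (2 * t))⁻¹)) := by
  rw [mehlerExp, ← Real.exp_add, cosh_two_mul_div ht, inv_sinh_two_mul ht]
  congr 1
  have := tanh_pos_of_pos ht
  field_simp
  ring

lemma hasDerivAt_heatClosed {β t : ℝ} (hβ : -(1 / 2) ≤ β) (x y : ℝ) :
    HasDerivAt (fun x' => heatClosed β t x' y)
      (2 * (2 * Real.sinh (2 * t))⁻¹ ^ (β + 1) *
        Real.exp (-(Real.cosh (2 * t) / Real.sinh (2 * t) * (x ^ 2 + y ^ 2) / 2)) *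
        (-(Real.cosh (2 * t) / Real.sinh (2 * t) * x) *
            besselE β ((x * y * (2 * Real.sinh (2 * t))⁻¹) ^ 2) +
          2 * x * (y * (2 * Real.sinh (2 * t))⁻¹) ^ 2 *
            besselE (β + 1) ((x * y * (2 * Real.sinh (2 * t))⁻¹) ^ 2))) x := by
  set c := Real.cosh (2 * t) / Real.sinh (2 * t)
  set s := (2 * Real.sinh (2 * t))⁻¹
  have h1 : HasDerivAt (fun x' : ℝ => -(c * (x' ^ 2 + y ^ 2) / 2)) (-(c * (2 * x) / 2)) x := by
    refine ((((hasDerivAt_pow 2 x).add_const (y ^ 2)).const_mul c).div_const 2).neg.congr_deriv ?_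
    simp
  have h2 : HasDerivAt (fun x' : ℝ => (x' * y * s) ^ 2) (2 * x * (y * s) ^ 2) x := by
    have := (((hasDerivAt_id x).mul_const y).mul_const s).pow 2
    refine this.congr_deriv ?_
    simp
    ring
  have h3 := (hasDerivAt_besselE hβ ((x * y * s) ^ 2)).comp x h2
  refine ((h1.exp.const_mul (2 * s ^ (β + 1))).mul h3).congr_deriv ?_
  simp only [Function.comp]
  ring

lemma hasDerivAt_heatKernel {β t : ℝ} (hβ : -(1 / 2) ≤ β) (ht : 0 < t) (x y : ℝ) :
    HasDerivAt (fun x' => heatKernel β t x' y)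
      (2 * (2 * Real.sinh (2 * t))⁻¹ ^ (β + 1) *
        Real.exp (-(Real.cosh (2 * t) / Real.sinh (2 * t) * (x ^ 2 + y ^ 2) / 2)) *
        (-(Real.cosh (2 * t) / Real.sinh (2 * t) * x) *
            besselE β ((x * y * (2 * Real.sinh (2 * t))⁻¹) ^ 2) +
          2 * x * (y * (2 * Real.sinh (2 * t))⁻¹) ^ 2 *
            besselE (β + 1) ((x * y * (2 * Real.sinh (2 * t))⁻¹) ^ 2))) x := by
  have : (fun x' => heatKernel β t x' y) = fun x' => heatClosed β t x' y :=
    funext fun x' => heatKernel_eq hβ ht x' y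
  rw [this]
  exact hasDerivAt_heatClosed hβ x y

/-- Since coth 2t = s + tanh t, the term x of δ combines with the Gaussian's -x coth 2t into x(1 -
tanh t) - xs, while the Bessel factor contributes ys at the next order. The power (xy)^b joins s^b
to form w^b, leaving s^(α+1). -/
lemma conjIntegrand_eq {α b t x y : ℝ} (hb : -(1 / 2) ≤ α + b) (ht : 0 < t) (hx : 0 < x)
    (hy : 0 < y) :
    (x * y) ^ b * delta (fun x' => heatKernel (α + b) t x' y) x = conjIntegrand α b t x y := by
  have hs := sinh_two_mul_pos ht
  rw [delta, (hasDerivAt_heatKernel hb ht x y).deriv, heatKernel_eq hb ht, heatClosed,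
    exp_eq_mehlerExp ht, cosh_two_mul_div ht, conjIntegrand, conjBracket]
  have e0 : (2 * Real.sinh (2 * t))⁻¹ = (Real.sinh (2 * t))⁻¹ / 2 := by field_simp
  rw [e0]
  set s := (Real.sinh (2 * t))⁻¹ with hs_def
  have hs0 : 0 < s := inv_pos.2 hs
  set w := x * y * s with hw_def
  have hxy : 0 < x * y := mul_pos hx hy
  have hw : 0 < w := mul_pos hxy hs0
  set P := (x * y) ^ b * s ^ b * s ^ (α + 1) * (2 : ℝ) ^ (-(α + b)) with hP
  have hz : (x * y * (s / 2)) ^ 2 = w ^ 2 / 4 := by rw [hw_def]; ring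
  have e1 : (x * y) ^ b * (2 * (s / 2) ^ (α + b + 1)) = P := by
    rw [hP, Real.div_rpow hs0.le (by norm_num), Real.rpow_neg (by norm_num),
      Real.rpow_add_one (by norm_num : (2 : ℝ) ≠ 0), show α + b + 1 = b + (α + 1) by ring,
      Real.rpow_add hs0]
    field_simp
  have e2 : w ^ (-α) * (w / 2) ^ (α + b) = (x * y) ^ b * s ^ b * (2 : ℝ) ^ (-(α + b)) := by
    rw [Real.div_rpow hw.le (by norm_num), Real.rpow_add hw, Real.rpow_neg hw.le,
      Real.rpow_neg (by norm_num), ← Real.mul_rpow hxy.le hs0.le, ← hw_def]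
    field_simp
  have e3 : s ^ (α + 1) * conjBessel α b w = P * (Real.exp (-w) * besselE (α + b) (w ^ 2 / 4)) := by
    rw [conjBessel, besselH, hP]
    linear_combination (s ^ (α + 1) * Real.exp (-w) * besselE (α + b) (w ^ 2 / 4)) * e2
  have e4 : s ^ (α + 1) * conjBessel α (b + 1) w =
      P * (Real.exp (-w) * (w / 2 * besselE (α + b + 1) (w ^ 2 / 4))) := by
    rw [conjBessel_succ, besselH_add_one _ hw, hP]
    linear_combination (s ^ (α + 1) * Real.exp (-w) *
      (w / 2 * besselE (α + b + 1) (w ^ 2 / 4))) * e2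
  rw [hz]
  set M := mehlerExp t x y
  set T := Real.tanh t
  linear_combination (M * Real.exp (-w) * ((1 - (s + T)) * x * besselE (α + b) (w ^ 2 / 4) +
    x * y ^ 2 * s ^ 2 / 2 * besselE (α + b + 1) (w ^ 2 / 4))) * e1 -
    M * (1 - s - T) * x * e3 - M * s * y * e4

/-! ### The gradient of the kernel under the integral sign -/

/-- The partial derivative of `conjBracket` in `x`. -/
def conjBracketX (α b t x y : ℝ) : ℝ :=
  let s := (Real.sinh (2 * t))⁻¹
  let w := x * y * s
  s * (y * (y * s) * conjBesselDeriv α (b + 1) w - conjBessel α b w -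
      w * conjBesselDeriv α b w) +
    (1 - Real.tanh t) * (conjBessel α b w + w * conjBesselDeriv α b w)

/-- The partial derivative of `conjBracket` in `y`. -/
def conjBracketY (α b t x y : ℝ) : ℝ :=
  let s := (Real.sinh (2 * t))⁻¹
  let w := x * y * s
  s * (conjBessel α (b + 1) w + w * conjBesselDeriv α (b + 1) w -
      x * (x * s) * conjBesselDeriv α b w) +
    (1 - Real.tanh t) * (x * (x * s) * conjBesselDeriv α b w)

/-- The partial derivative of `conjIntegrand` in `x`. -/
def conjIntegrandX (α b t x y : ℝ) : ℝ :=
  (Real.sinh (2 * t))⁻¹ ^ (α + 1) * (mehlerExp t x y *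
    (conjBracketX α b t x y -
      (Real.tanh t * (x + y) + (x - y) / Real.tanh t) / 2 * conjBracket α b t x y))

/-- The partial derivative of `conjIntegrand` in `y`. -/
def conjIntegrandY (α b t x y : ℝ) : ℝ :=
  (Real.sinh (2 * t))⁻¹ ^ (α + 1) * (mehlerExp t x y *
    (conjBracketY α b t x y -
      (Real.tanh t * (x + y) - (x - y) / Real.tanh t) / 2 * conjBracket α b t x y))

/-- The linear form with coordinates `u` and `v` on the Euclidean plane. -/
def planeForm (u v : ℝ) : EuclideanSpace ℝ (Fin 2) →L[ℝ] ℝ :=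
  u • EuclideanSpace.proj (0 : Fin 2) + v • EuclideanSpace.proj (1 : Fin 2)

lemma planeForm_apply (u v : ℝ) (q : EuclideanSpace ℝ (Fin 2)) :
    planeForm u v q = u * q 0 + v * q 1 := by
  simp [planeForm]

lemma norm_planeForm_le (u v : ℝ) : ‖planeForm u v‖ ≤ |u| + |v| := by
  refine ContinuousLinearMap.opNorm_le_bound _ (by positivity) fun q => ?_
  rw [planeForm_apply, Real.norm_eq_abs]
  have h : ∀ i : Fin 2, |q i| ≤ ‖q‖ := fun i => by
    rw [← Real.norm_eq_abs]; exact PiLp.norm_apply_le q i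
  calc |u * q 0 + v * q 1| ≤ |u * q 0| + |v * q 1| := abs_add_le _ _
    _ = |u| * |q 0| + |v| * |q 1| := by rw [abs_mul, abs_mul]
    _ ≤ |u| * ‖q‖ + |v| * ‖q‖ := by gcongr <;> exact h _
    _ = _ := by ring

lemma continuous_planeForm : Continuous fun p : ℝ × ℝ => planeForm p.1 p.2 := by
  unfold planeForm
  fun_prop

lemma hasFDerivAt_conjIntegrand {α b t : ℝ} (hα : -(1 / 2) ≤ α) (hb : 0 ≤ b) (ht : 0 < t)
    {p : EuclideanSpace ℝ (Fin 2)} (hx : 0 < p 0) (hy : 0 < p 1) :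
    HasFDerivAt (fun q : EuclideanSpace ℝ (Fin 2) => conjIntegrand α b t (q 0) (q 1))
      (planeForm (conjIntegrandX α b t (p 0) (p 1)) (conjIntegrandY α b t (p 0) (p 1))) p := by
  have hs := inv_pos.2 (sinh_two_mul_pos ht)
  have hT := tanh_pos_of_pos ht
  have f0 : HasFDerivAt (fun q : EuclideanSpace ℝ (Fin 2) => q 0) (planeForm 1 0) p := by
    have := (EuclideanSpace.proj (0 : Fin 2) : EuclideanSpace ℝ (Fin 2) →L[ℝ] ℝ).hasFDerivAt
      (x := p)
    refine this.congr_fderiv ?_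
    simp [planeForm]
  have f1 : HasFDerivAt (fun q : EuclideanSpace ℝ (Fin 2) => q 1) (planeForm 0 1) p := by
    have := (EuclideanSpace.proj (1 : Fin 2) : EuclideanSpace ℝ (Fin 2) →L[ℝ] ℝ).hasFDerivAt
      (x := p)
    refine this.congr_fderiv ?_
    simp [planeForm]
  unfold conjIntegrand conjBracket mehlerExp conjIntegrandX conjIntegrandY conjBracketX
    conjBracketY conjBracket mehlerExp
  set s := (Real.sinh (2 * t))⁻¹
  set T := Real.tanh t
  have hw : 0 < p 0 * p 1 * s := by positivity
  have fw := (f0.mul f1).mul_const s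
  have g0 := (hasDerivAt_conjBessel (α := α) (b := b) (by linarith) hw).comp_hasFDerivAt p fw
  have g1 := (hasDerivAt_conjBessel (α := α) (b := b + 1) (by linarith) hw).comp_hasFDerivAt p fw
  have e1 := (((((f0.add f1).pow 2).const_mul T).add
    (((f0.sub f1).pow 2).mul_const T⁻¹)).mul_const (4 : ℝ)⁻¹).neg.exp
  have e2 := (((f1.mul g1).sub (f0.mul g0)).const_mul s).add ((f0.mul g0).const_mul (1 - T))
  refine ((e1.mul e2).const_mul (s ^ (α + 1))).congr_fderiv ?_
  ext q
  simp only [planeForm_apply, add_apply, smul_apply,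
    sub_apply, neg_apply, smul_eq_mul, Function.comp,
    Pi.mul_apply, Pi.add_apply, Pi.sub_apply, Pi.neg_apply, nsmul_eq_mul,
    div_eq_mul_inv]
  push_cast
  ring

lemma continuousOn_conjIntegrand {α b x y : ℝ} (hα : -(1 / 2) ≤ α) (hb : 0 ≤ b) (hx : 0 < x)
    (hy : 0 < y) :
    ContinuousOn (fun t => conjIntegrand α b t x y) (Set.Ioi 0) ∧
    ContinuousOn (fun t => conjIntegrandX α b t x y) (Set.Ioi 0) ∧
    ContinuousOn (fun t => conjIntegrandY α b t x y) (Set.Ioi 0) := by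
  have cs : ContinuousOn (fun t : ℝ => (Real.sinh (2 * t))⁻¹) (Set.Ioi 0) :=
    (by fun_prop : Continuous fun t : ℝ => Real.sinh (2 * t)).continuousOn.inv₀
      fun t ht => (sinh_two_mul_pos ht).ne'
  have cT : ContinuousOn (fun t : ℝ => Real.tanh t) (Set.Ioi 0) := by
    simp only [Real.tanh_eq_sinh_div_cosh]
    exact (Real.continuous_sinh.div Real.continuous_cosh
      fun t => (Real.cosh_pos t).ne').continuousOn
  have cTi : ContinuousOn (fun t : ℝ => (Real.tanh t)⁻¹) (Set.Ioi 0) :=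
    cT.inv₀ fun t ht => (tanh_pos_of_pos ht).ne'
  have cp : ContinuousOn (fun t : ℝ => (Real.sinh (2 * t))⁻¹ ^ (α + 1)) (Set.Ioi 0) :=
    cs.rpow_const fun t ht => Or.inl (inv_pos.2 (sinh_two_mul_pos ht)).ne'
  have cw : ContinuousOn (fun t : ℝ => x * y * (Real.sinh (2 * t))⁻¹) (Set.Ioi 0) :=
    continuousOn_const.mul cs
  have hm : Set.MapsTo (fun t : ℝ => x * y * (Real.sinh (2 * t))⁻¹) (Set.Ioi 0) (Set.Ioi 0) :=
    fun t ht => mul_pos (mul_pos hx hy) (inv_pos.2 (sinh_two_mul_pos ht))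
  have c0 := (continuousOn_conjBessel (α := α) (b := b) (by linarith)).comp cw hm
  have c1 := (continuousOn_conjBessel (α := α) (b := b + 1) (by linarith)).comp cw hm
  have d0 := (continuousOn_conjBesselDeriv (α := α) (b := b) (by linarith)).comp cw hm
  have d1 := (continuousOn_conjBesselDeriv (α := α) (b := b + 1) (by linarith)).comp cw hm
  simp only [Function.comp_def] at c0 c1 d0 d1
  unfold conjIntegrand conjIntegrandX conjIntegrandY conjBracketX conjBracketY conjBracket
    mehlerExp
  simp only [div_eq_mul_inv]
  refine ⟨?_, ?_, ?_⟩ <;> fun_prop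

/-! ### Pointwise estimates of the kernel under the integral sign -/

lemma sinh_le_mul_cosh {t : ℝ} (ht : 0 < t) : Real.sinh t ≤ t * Real.cosh t := by
  obtain ⟨ξ, ⟨h0, h1⟩, h⟩ := exists_deriv_eq_slope Real.sinh ht Real.continuous_sinh.continuousOn
    Real.differentiable_sinh.differentiableOn
  rw [Real.deriv_sinh, Real.sinh_zero, sub_zero, sub_zero, eq_div_iff ht.ne'] at h
  have : Real.cosh ξ ≤ Real.cosh t := by
    rw [Real.cosh_le_cosh, abs_of_pos h0, abs_of_pos ht]; exact h1.le
  nlinarith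

lemma tanh_le_self {t : ℝ} (ht : 0 < t) : Real.tanh t ≤ t := by
  rw [Real.tanh_eq_sinh_div_cosh, div_le_iff₀ (Real.cosh_pos t)]
  exact sinh_le_mul_cosh ht

lemma tanh_le_one (t : ℝ) : Real.tanh t ≤ 1 := by
  rw [Real.tanh_eq_sinh_div_cosh, div_le_one (Real.cosh_pos t)]
  exact (Real.sinh_lt_cosh t).le

lemma mul_one_sub_tanh_le {t : ℝ} (ht : 0 < t) : t * (1 - Real.tanh t) ≤ Real.tanh t := by
  have hc := Real.cosh_pos t
  have h1 : t ≤ Real.sinh t := (Real.self_le_sinh_iff.2 ht.le)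
  have h2 : Real.cosh t - Real.sinh t ≤ 1 := by
    rw [Real.cosh_sub_sinh, Real.exp_le_one_iff]; linarith
  have h3 := Real.sinh_lt_cosh t
  rw [Real.tanh_eq_sinh_div_cosh, one_sub_div hc.ne', ← mul_div_assoc]
  gcongr
  nlinarith

lemma inv_sinh_le {t : ℝ} (ht : 0 < t) : (Real.sinh (2 * t))⁻¹ ≤ 1 / t := by
  rw [← one_div]
  have : 2 * t ≤ Real.sinh (2 * t) := Real.self_le_sinh_iff.2 (by linarith)
  exact one_div_le_one_div_of_le ht (by linarith)

lemma inv_sinh_div_tanh_le {t : ℝ} (ht : 0 < t) :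
    (Real.sinh (2 * t))⁻¹ / Real.tanh t ≤ 1 / t ^ 2 := by
  have hs := Real.sinh_pos_iff.2 ht
  have hc := Real.cosh_pos t
  have h1 : t ≤ Real.sinh t := Real.self_le_sinh_iff.2 ht.le
  have e : (Real.sinh (2 * t))⁻¹ / Real.tanh t = 1 / (2 * Real.sinh t ^ 2) := by
    rw [Real.tanh_eq_sinh_div_cosh, Real.sinh_two_mul]; field_simp
  rw [e]
  exact one_div_le_one_div_of_le (by positivity) (by nlinarith)

lemma rpow_mul_exp_neg_le {q N : ℝ} (hq : 0 < q) (hN : 0 < N) :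
    N ^ q * Real.exp (-(N / 4)) ≤ (4 * q) ^ q := by
  have h1 : N / (4 * q) ≤ Real.exp (N / (4 * q)) := by
    linarith [Real.add_one_le_exp (N / (4 * q))]
  have h2 : N ≤ 4 * q * Real.exp (N / (4 * q)) := by
    rw [div_le_iff₀ (by positivity)] at h1; linarith
  calc N ^ q * Real.exp (-(N / 4))
      ≤ (4 * q * Real.exp (N / (4 * q))) ^ q * Real.exp (-(N / 4)) := by gcongr
    _ = (4 * q) ^ q := by
      rw [Real.mul_rpow (by positivity) (by positivity), ← Real.exp_mul, mul_assoc, ← Real.exp_add,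
        show N / (4 * q) * q + -(N / 4) = 0 by field_simp; ring, Real.exp_zero, mul_one]

/-- With w = xys, s(x+y)² = s(x-y)² + 4w ≤ (4 + X)(1 + w). The power α + 1/2 of this is what
produces (x+y)^(-2α-1). -/
lemma rpow_mul_besselWeight_le {α s x y X : ℝ} (hα : -(1 / 2) ≤ α) (hs : 0 < s) (hx : 0 < x)
    (hy : 0 < y) (hX : s * (x - y) ^ 2 ≤ X) :
    s ^ (α + 1) * besselWeight α (x * y * s) ≤
      √s * ((x + y) ^ (-(2 * α + 1)) * (4 + X) ^ (α + 1 / 2)) := by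
  have hp : 0 ≤ α + 1 / 2 := by linarith
  have hw : 0 < x * y * s := by positivity
  have hX0 : 0 ≤ X := le_trans (by positivity) hX
  have h1 : s / (1 + x * y * s) ≤ (4 + X) / (x + y) ^ 2 := by
    rw [div_le_div_iff₀ (by positivity) (by positivity)]
    nlinarith
  have e1 : s ^ (α + 1) * besselWeight α (x * y * s) =
      √s * (s / (1 + x * y * s)) ^ (α + 1 / 2) := by
    rw [besselWeight, Real.div_rpow hs.le (by positivity), Real.rpow_neg (by positivity),
      Real.sqrt_eq_rpow, show α + 1 = 1 / 2 + (α + 1 / 2) by ring, Real.rpow_add hs]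
    ring
  have e2 : (x + y) ^ (-(2 * α + 1)) * (4 + X) ^ (α + 1 / 2) =
      ((4 + X) / (x + y) ^ 2) ^ (α + 1 / 2) := by
    rw [Real.div_rpow (by positivity) (by positivity), Real.rpow_neg (by positivity),
      ← Real.rpow_natCast, ← Real.rpow_mul (by positivity)]
    rw [show ((2 : ℕ) : ℝ) * (α + 1 / 2) = 2 * α + 1 by push_cast; ring]
    ring
  rw [e1, e2]
  gcongr

/-- Either x ≤ 2y, or x - y ≥ x/2. The factor 1 + w, with w = xys, will be absorbed by the decay of
the Bessel terms. -/
lemma sq_mul_div_le {s x y : ℝ} (hs : 0 < s) (hx : 0 < x) (hy : 0 < y) :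
    x ^ 2 * s ≤ (2 + 4 * (s * (x - y) ^ 2)) * (1 + x * y * s) := by
  have h1 : x ^ 2 ≤ 2 * (x * y) + 4 * (x - y) ^ 2 := by
    rcases le_total x (2 * y) with h | h
    · nlinarith [sq_nonneg (x - y)]
    · nlinarith
  have h2 : x ^ 2 * s ≤ (2 * (x * y) + 4 * (x - y) ^ 2) * s := by gcongr
  have h3 : 0 ≤ s * (x - y) ^ 2 * (x * y * s) := by positivity
  nlinarith

lemma sqrt_le_of_le_sq {a b : ℝ} (hb : 0 ≤ b) (h : a ≤ b ^ 2) : √a ≤ b :=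
  Real.sqrt_le_iff.2 ⟨hb, h⟩

lemma mehlerExp_eq (t x y : ℝ) :
    mehlerExp t x y = Real.exp (1 / 4) * Real.exp (-((1 + Real.tanh t * (x + y) ^ 2 +
      (x - y) ^ 2 / Real.tanh t) / 4)) := by
  rw [mehlerExp, ← Real.exp_add]
  congr 1
  ring

set_option maxHeartbeats 1000000 in
/-- The bounds of the factors of `conjIntegrand` and of its derivatives, in terms of
`N = 1 + tanh t (x + y)² + (x - y)² / tanh t`. -/
lemma conjBracket_bounds {α : ℝ} (hα : -(1 / 2) ≤ α) :
    ∃ C : ℝ, 0 < C ∧ ∀ b t x y : ℝ, (b = 0 ∨ 1 ≤ b) → 0 < t → 0 < x → 0 < y →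
      ∀ N : ℝ, N = 1 + Real.tanh t * (x + y) ^ 2 + (x - y) ^ 2 / Real.tanh t →
      |conjBracket α b t x y| ≤
        C * besselWeight α (x * y * (Real.sinh (2 * t))⁻¹) * (√(1 / t) * N) ∧
      |conjBracketX α b t x y| ≤
        C * besselWeight α (x * y * (Real.sinh (2 * t))⁻¹) * (1 / t * N) ∧
      |conjBracketY α b t x y| ≤
        C * besselWeight α (x * y * (Real.sinh (2 * t))⁻¹) * (1 / t * N) := by
  obtain ⟨C, hC, H⟩ := conjBessel_bounds hα
  refine ⟨12 * C, by positivity, fun b t x y hb ht hx hy N hN => ?_⟩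
  have hb0 : 0 ≤ b := by rcases hb with h | h <;> linarith
  have hs := inv_pos.2 (sinh_two_mul_pos ht)
  have hT := tanh_pos_of_pos ht
  have hsle := inv_sinh_le ht
  have hT1 := tanh_le_one t
  have hTt := tanh_le_self ht
  have hTm := mul_one_sub_tanh_le ht
  unfold conjBracket conjBracketX conjBracketY
  simp only
  set s := (Real.sinh (2 * t))⁻¹
  set T := Real.tanh t
  set w := x * y * s with hw_def
  have hw : 0 < w := by positivity
  have hφ := besselWeight_pos (α := α) hw
  obtain ⟨a1, a2, a3⟩ := H b w hb hw
  obtain ⟨b1, -, b3⟩ := H (b + 1) w (Or.inr (by linarith)) hw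
  have p0 := conjBessel_pos (show -(1 / 2) ≤ α + b by linarith) hw
  have p1 := conjBessel_pos (show -(1 / 2) ≤ α + (b + 1) by linarith) hw
  set φ := C * besselWeight α w with hφ_def
  have hφ0 : 0 < φ := mul_pos hC hφ
  set h0 := conjBessel α b w
  set h1 := conjBessel α (b + 1) w
  set d0 := conjBesselDeriv α b w
  set d1 := conjBesselDeriv α (b + 1) w
  set Y := T * (x + y) ^ 2 with hY
  set V := (x - y) ^ 2 / T with hV
  have hY0 : 0 ≤ Y := by positivity
  have hV0 : 0 ≤ V := by positivity
  have hit : 0 < 1 / t := by positivity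
  have hD : (x - y) ^ 2 * (1 / t) ≤ V := by
    rw [hV, mul_one_div]; gcongr
  have hsV : s * (x - y) ^ 2 ≤ V := by
    refine le_trans ?_ hD
    rw [mul_comm]; gcongr
  have hN1 : 1 ≤ N := by rw [hN]; linarith only [hY0, hV0]
  have hNV : V ≤ N := by rw [hN]; linarith only [hY0]
  have hNY : Y ≤ N := by rw [hN]; linarith only [hV0]
  have hNN : N ≤ N ^ 2 := by rw [sq]; exact le_mul_of_one_le_left (by linarith only [hN1]) hN1
  have hT1' : 0 ≤ 1 - T := by linarith
  have h1T : 1 - T ≤ 1 / t := by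
    rw [le_div_iff₀ ht]; linarith
  have hx2 : x ^ 2 * s ≤ 4 * N * (1 + w) := by
    refine (sq_mul_div_le hs hx hy).trans ?_
    gcongr
    linarith only [hN, hY0, hsV, hN1, hNV]
  have hy2 : y ^ 2 * s ≤ 4 * N * (1 + w) := by
    have := sq_mul_div_le hs hy hx
    rw [show (y - x) ^ 2 = (x - y) ^ 2 by ring, show y * x = x * y by ring] at this
    refine this.trans ?_
    gcongr
    linarith only [hN, hY0, hsV, hN1, hNV]
  have hdw : ∀ d u : ℝ, 0 ≤ u → |d| * (1 + w) ≤ φ → u ≤ 4 * N * (1 + w) → |u * d| ≤ 4 * N * φ :=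
    fun d u hu hd hu' => by
      rw [abs_mul, abs_of_nonneg hu]
      calc u * |d| ≤ 4 * N * (1 + w) * |d| := by gcongr
        _ = 4 * N * (|d| * (1 + w)) := by ring
        _ ≤ 4 * N * φ := by gcongr
  have hdw' : ∀ d : ℝ, |d| * (1 + w) ≤ φ → |w * d| ≤ φ := fun d hd => by
    rw [abs_mul, abs_of_pos hw]
    have := abs_nonneg d
    linarith
  have A1 := abs_le.1 (hdw d1 (y * (y * s)) (by positivity) b3 (by linarith [hy2]))
  have A2 := abs_le.1 (hdw d0 (x * (x * s)) (by positivity) a3 (by linarith [hx2]))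
  have A3 := abs_le.1 (hdw' d0 a3)
  have A4 := abs_le.1 (hdw' d1 b3)
  have hNφ : φ ≤ N * φ := le_mul_of_one_le_left hφ0.le hN1
  have hN0φ : 0 ≤ N * φ := hφ0.le.trans hNφ
  -- Both s and 1 - tanh t are at most 1/t, so for the partial derivatives no cancellation is
  -- needed.
  have comb : ∀ P Q p q : ℝ, |P| ≤ p → |Q| ≤ q → p + q ≤ 12 * N * φ →
      |s * P + (1 - T) * Q| ≤ 12 * C * besselWeight α w * (1 / t * N) := fun P Q p q hP hQ hpq => by
    calc |s * P + (1 - T) * Q| ≤ |s * P| + |(1 - T) * Q| := abs_add_le _ _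
      _ = s * |P| + (1 - T) * |Q| := by
        rw [abs_mul, abs_mul, abs_of_pos hs, abs_of_nonneg hT1']
      _ ≤ 1 / t * p + 1 / t * q := by gcongr
      _ = 1 / t * (p + q) := by ring
      _ ≤ 1 / t * (12 * N * φ) := by gcongr
      _ = _ := by rw [hφ_def]; ring
  refine ⟨?_, ?_, ?_⟩
  · have r0 : 0 < √(1 / t) := Real.sqrt_pos.2 hit
    have hss : √s ≤ √(1 / t) := Real.sqrt_le_sqrt hsle
    have hss2 : √s * √s = s := Real.mul_self_sqrt hs.le
    have i1 : s * |y - x| ≤ √(1 / t) * N := by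
      have j1 : √s * |y - x| ≤ N := by
        rw [← Real.sqrt_sq_eq_abs, ← Real.sqrt_mul hs.le]
        apply sqrt_le_of_le_sq (by linarith)
        rw [show (y - x) ^ 2 = (x - y) ^ 2 by ring]
        exact hsV.trans (hNV.trans hNN)
      calc s * |y - x| = √s * (√s * |y - x|) := by rw [← mul_assoc, hss2]
        _ ≤ √(1 / t) * N := by gcongr
    have i2 : s * (y * |h0 - h1|) ≤ √(1 / t) * (2 * N) * φ := by
      have j1 : √s * y ≤ 2 * N * √(1 + w) := by
        have : √s * y = √(y ^ 2 * s) := by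
          rw [Real.sqrt_mul (by positivity), Real.sqrt_sq hy.le, mul_comm]
        rw [this]
        apply sqrt_le_of_le_sq (by positivity)
        rw [mul_pow, Real.sq_sqrt (by positivity)]
        refine hy2.trans ?_
        gcongr
        linarith only [hNN]
      calc s * (y * |h0 - h1|) = √s * ((√s * y) * |h0 - h1|) := by
            rw [← mul_assoc, ← mul_assoc, ← mul_assoc, hss2]
        _ ≤ √(1 / t) * ((2 * N * √(1 + w)) * |h0 - h1|) := by gcongr
        _ = √(1 / t) * (2 * N * (|h0 - h1| * √(1 + w))) := by ring
        _ ≤ √(1 / t) * (2 * N * φ) := by gcongr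
        _ = _ := by ring
    have i3 : (1 - T) * x ≤ √(1 / t) * N := by
      have j1 : (1 - T) * x = √(((1 - T) * x) ^ 2) := (Real.sqrt_sq (by positivity)).symm
      have j2 : √(1 / t) * N = √(1 / t * N ^ 2) := by
        rw [Real.sqrt_mul hit.le, Real.sqrt_sq (by linarith)]
      rw [j1, j2]
      apply Real.sqrt_le_sqrt
      have j3 : (1 - T) ^ 2 ≤ 1 / t * T := by
        have : 1 - T ≤ 1 / t * T := by
          rw [one_div_mul_eq_div, le_div_iff₀ ht]; linarith
        rw [sq]
        exact (mul_le_of_le_one_left hT1' (by linarith only [hT])).trans this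
      calc ((1 - T) * x) ^ 2 = (1 - T) ^ 2 * x ^ 2 := by ring
        _ ≤ 1 / t * T * (x + y) ^ 2 := by
          gcongr
          linarith
        _ = 1 / t * Y := by rw [hY]; ring
        _ ≤ 1 / t * N ^ 2 := by
          gcongr
          exact hNY.trans hNN
    -- The size bound affords only t^(-1/2), while s may be as large as 1/t. The missing √s is
    -- recovered from |y - x| in the first term and from the extra decay of h0 - h1 in the second.
    have e : s * (y * h1 - x * h0) + (1 - T) * (x * h0) =
        s * (y - x) * h0 - s * (y * (h0 - h1)) + (1 - T) * x * h0 := by ring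
    rw [e]
    have k1 : |s * (y - x) * h0| ≤ √(1 / t) * N * φ := by
      rw [abs_mul, abs_mul, abs_of_pos hs, abs_of_pos p0]
      gcongr
    have k2 : |s * (y * (h0 - h1))| ≤ √(1 / t) * (2 * N) * φ := by
      rw [abs_mul, abs_mul, abs_of_pos hs, abs_of_pos hy]
      exact i2
    have k3 : |(1 - T) * x * h0| ≤ √(1 / t) * N * φ := by
      rw [abs_of_nonneg (by positivity)]
      gcongr
    have k4 : 0 ≤ √(1 / t) * N * φ := by positivity
    have k5 : 12 * C * besselWeight α w * (√(1 / t) * N) = 12 * (√(1 / t) * N * φ) := by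
      rw [hφ_def]; ring
    rw [k5]
    rw [abs_le] at k1 k2 k3 ⊢
    constructor <;> linarith only [k1, k2, k3, k4]
  · refine comb _ _ (6 * N * φ) (2 * N * φ) ?_ ?_ (by linarith only [hN0φ])
    · rw [abs_le]; constructor <;> linarith only [A1, A2, A3, A4, a1, b1, p0, p1, hNφ, hφ0]
    · rw [abs_le]; constructor <;> linarith only [A1, A2, A3, A4, a1, b1, p0, p1, hNφ, hφ0]
  · refine comb _ _ (6 * N * φ) (4 * N * φ) ?_ ?_ (by linarith only [hN0φ])
    · rw [abs_le]; constructor <;> linarith only [A1, A2, A3, A4, a1, b1, p0, p1, hNφ, hφ0]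
    · rw [abs_le]; constructor <;> linarith only [A1, A2, A3, A4, a1, b1, p0, p1, hNφ, hφ0]

/-- The exponential absorbs N^(p+2+θ); the spare N^θ turns t^(-θ) into (tN)^(-θ). -/
lemma rpow_neg_mul_exp_le {p θ t N Z : ℝ} (hp : 0 ≤ p) (hθ : 0 < θ) (ht : 0 < t) (hN : 0 < N)
    (hZ : 0 < Z) (hZN : Z ≤ t * N) :
    t ^ (-θ) * ((4 * N) ^ p * N ^ 2 * Real.exp (-(N / 4))) ≤
      4 ^ p * (4 * (p + 2 + θ)) ^ (p + 2 + θ) * Z ^ (-θ) := by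
  have h1 := rpow_mul_exp_neg_le (show 0 < p + 2 + θ by linarith) hN
  have h2 : (t * N) ^ (-θ) ≤ Z ^ (-θ) :=
    Real.rpow_le_rpow_of_nonpos hZ hZN (by linarith)
  have e : t ^ (-θ) * ((4 * N) ^ p * N ^ 2 * Real.exp (-(N / 4))) =
      4 ^ p * (N ^ (p + 2 + θ) * Real.exp (-(N / 4))) * (t * N) ^ (-θ) := by
    rw [Real.mul_rpow ht.le hN.le, Real.mul_rpow (by norm_num) hN.le, Real.rpow_add hN,
      Real.rpow_add hN, Real.rpow_neg hN.le θ, Real.rpow_ofNat]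
    field_simp
  rw [e]
  gcongr

lemma abs_mehlerExp_deriv_le {T x y N : ℝ} (hT : 0 < T) (hT1 : T ≤ 1)
    (hN : N = 1 + T * (x + y) ^ 2 + (x - y) ^ 2 / T) :
    |T * (x + y)| + |(x - y) / T| ≤ 2 * (N / √T) := by
  have hr : 0 < √T := Real.sqrt_pos.2 hT
  have hr2 : √T ^ 2 = T := Real.sq_sqrt hT.le
  have hr1 : √T ≤ 1 := Real.sqrt_le_one.2 hT1
  have hY0 : 0 ≤ T * (x + y) ^ 2 := by positivity
  have hV0 : 0 ≤ (x - y) ^ 2 / T := by positivity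
  have hN1 : 1 ≤ N := by rw [hN]; linarith
  have hNN : N ≤ N ^ 2 := by rw [sq]; exact le_mul_of_one_le_left (by linarith) hN1
  have i1 : |T * (x + y)| ≤ N := by
    rw [← Real.sqrt_sq_eq_abs]
    apply sqrt_le_of_le_sq (by linarith)
    have : (T * (x + y)) ^ 2 = T * (T * (x + y) ^ 2) := by ring
    rw [this]
    have : T * (T * (x + y) ^ 2) ≤ 1 * (T * (x + y) ^ 2) := by gcongr
    linarith
  have i2 : N ≤ N / √T := le_div_self (by linarith) hr hr1
  have i3 : |(x - y) / T| ≤ N / √T := by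
    have e : (x - y) / T = ((x - y) / √T) / √T := by
      rw [div_div, ← sq, hr2]
    rw [e, abs_div, abs_of_pos hr]
    gcongr
    rw [← Real.sqrt_sq_eq_abs]
    apply sqrt_le_of_le_sq (by linarith)
    rw [div_pow, hr2]
    linarith
  linarith

/-- The estimates of the kernel under the integral sign and of its gradient. -/
theorem conjIntegrand_bounds {α : ℝ} (hα : -(1 / 2) ≤ α) :
    ∃ C : ℝ, 0 < C ∧ ∀ b t x y : ℝ, (b = 0 ∨ 1 ≤ b) → 0 < t → 0 < x → 0 < y →
      |conjIntegrand α b t x y| * t ^ (-(1 / 2) : ℝ) ≤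
        C * (x + y) ^ (-(2 * α + 1)) * (t + (x - y) ^ 2) ^ (-(3 / 2) : ℝ) ∧
      |conjIntegrandX α b t x y| * t ^ (-(1 / 2) : ℝ) ≤
        C * (x + y) ^ (-(2 * α + 1)) * (t + (x - y) ^ 2) ^ (-2 : ℝ) ∧
      |conjIntegrandY α b t x y| * t ^ (-(1 / 2) : ℝ) ≤
        C * (x + y) ^ (-(2 * α + 1)) * (t + (x - y) ^ 2) ^ (-2 : ℝ) := by
  obtain ⟨C, hC, H⟩ := conjBracket_bounds hα
  have hp : 0 ≤ α + 1 / 2 := by linarith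
  set K : ℝ → ℝ := fun θ =>
    4 ^ (α + 1 / 2) * (4 * (α + 1 / 2 + 2 + θ)) ^ (α + 1 / 2 + 2 + θ) with hK
  have hK0 : ∀ θ, 0 < θ → 0 < K θ := fun θ hθ => by
    have : 0 < α + 1 / 2 + 2 + θ := by linarith
    rw [hK]
    positivity
  refine ⟨2 * C * Real.exp (1 / 4) * (K (3 / 2) + K 2),
    by have := hK0 (3 / 2) (by norm_num); have := hK0 2 (by norm_num); positivity,
    fun b t x y hb ht hx hy => ?_⟩
  set N := 1 + Real.tanh t * (x + y) ^ 2 + (x - y) ^ 2 / Real.tanh t with hN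
  obtain ⟨h1, h2, h3⟩ := H b t x y hb ht hx hy N hN
  have hs := inv_pos.2 (sinh_two_mul_pos ht)
  have hT := tanh_pos_of_pos ht
  have hsle := inv_sinh_le ht
  have hsT := inv_sinh_div_tanh_le ht
  have hT1 := tanh_le_one t
  have hTt := tanh_le_self ht
  have hE := abs_mehlerExp_deriv_le hT hT1 hN
  have hM := mehlerExp_eq t x y
  rw [← hN] at hM
  have hMpos : 0 < mehlerExp t x y := Real.exp_pos _
  have hY0 : 0 ≤ Real.tanh t * (x + y) ^ 2 := by positivity
  have hV0 : 0 ≤ (x - y) ^ 2 / Real.tanh t := by positivity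
  have hN1 : 1 ≤ N := by linarith
  have hN0 : 0 < N := by linarith
  have hD : (x - y) ^ 2 ≤ t * ((x - y) ^ 2 / Real.tanh t) := by
    rw [mul_div_assoc', le_div_iff₀ hT, mul_comm]
    gcongr
  -- Here tanh t ≤ t is used, and the 1 in N supplies the summand t.
  have hZN : t + (x - y) ^ 2 ≤ t * N := by
    have : 0 ≤ t * (Real.tanh t * (x + y) ^ 2) := by positivity
    rw [hN]; linarith
  have hsV : (Real.sinh (2 * t))⁻¹ * (x - y) ^ 2 ≤ (x - y) ^ 2 / Real.tanh t := by
    calc (Real.sinh (2 * t))⁻¹ * (x - y) ^ 2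
        ≤ 1 / t * (t * ((x - y) ^ 2 / Real.tanh t)) := by gcongr
      _ = _ := by field_simp
  have hW := rpow_mul_besselWeight_le hα hs hx hy hsV
  have h4V : 4 + (x - y) ^ 2 / Real.tanh t ≤ 4 * N := by linarith
  set s := (Real.sinh (2 * t))⁻¹
  set T := Real.tanh t
  set S := (x + y) ^ (-(2 * α + 1)) with hS
  have hS0 : 0 < S := by positivity
  have hsp : 0 < s ^ (α + 1) := by positivity
  have hW' : s ^ (α + 1) * besselWeight α (x * y * s) ≤ √s * (S * (4 * N) ^ (α + 1 / 2)) := by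
    refine hW.trans ?_
    gcongr
  have hφ := besselWeight_pos (α := α) (show 0 < x * y * s by positivity)
  set W := besselWeight α (x * y * s)
  set G := S * (4 * N) ^ (α + 1 / 2) with hG
  have hG0 : 0 < G := by positivity
  set M := mehlerExp t x y
  set r := √(1 / t) with hr_def
  have hr : 0 < r := Real.sqrt_pos.2 (by positivity)
  have hr2 : r * r = 1 / t := Real.mul_self_sqrt (by positivity)
  have hrt : r = t ^ (-(1 / 2) : ℝ) := by
    rw [hr_def, Real.sqrt_eq_rpow, Real.div_rpow zero_le_one ht.le, Real.one_rpow,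
      Real.rpow_neg ht.le, one_div]
  have hsr : √s ≤ r := Real.sqrt_le_sqrt hsle
  -- For large t, 1/√T alone is not controlled by t^(-1/2). It is paired with the √s left over from
  -- the weight estimate.
  have hsTr : √s * (1 / √T) ≤ 1 / t := by
    rw [mul_one_div, ← Real.sqrt_div hs.le]
    apply sqrt_le_of_le_sq (by positivity)
    rw [div_pow, one_pow]
    exact hsT
  have e32 : t ^ (-(3 / 2) : ℝ) = r * r * r := by
    rw [hrt, ← Real.rpow_add ht, ← Real.rpow_add ht]; norm_num
  have e2 : t ^ (-2 : ℝ) = r * r * r * r := by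
    rw [hrt, ← Real.rpow_add ht, ← Real.rpow_add ht, ← Real.rpow_add ht]; norm_num
  have hZ : 0 < t + (x - y) ^ 2 := by positivity
  have k1 := rpow_neg_mul_exp_le hp (show (0 : ℝ) < 3 / 2 by norm_num) ht hN0 hZ hZN
  have k2 := rpow_neg_mul_exp_le hp (show (0 : ℝ) < 2 by norm_num) ht hN0 hZ hZN
  rw [e32] at k1
  rw [e2] at k2
  have hK1 := hK0 (3 / 2) (by norm_num)
  have hK2 := hK0 2 (by norm_num)
  have hgrad : ∀ B₁ B₂ q : ℝ, |B₁| ≤ C * W * (1 / t * N) → |B₂| ≤ C * W * (r * N) →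
      |q| ≤ N / √T →
      |s ^ (α + 1) * (M * (B₁ - q * B₂))| * r ≤
        2 * C * Real.exp (1 / 4) * (K (3 / 2) + K 2) * S * (t + (x - y) ^ 2) ^ (-2 : ℝ) :=
    fun B₁ B₂ q hB₁ hB₂ hq => by
    have l1 : |B₁ - q * B₂| ≤ C * W * (1 / t * N) + N / √T * (C * W * (r * N)) := by
      refine (abs_sub _ _).trans ?_
      rw [abs_mul]
      gcongr
    have hNN : N ≤ N ^ 2 := by rw [sq]; exact le_mul_of_one_le_left hN0.le hN1
    calc |s ^ (α + 1) * (M * (B₁ - q * B₂))| * r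
        = s ^ (α + 1) * (M * |B₁ - q * B₂|) * r := by
          rw [abs_mul, abs_mul, abs_of_pos hsp, abs_of_pos hMpos]
      _ ≤ s ^ (α + 1) * (M * (C * W * (1 / t * N) + N / √T * (C * W * (r * N)))) * r := by gcongr
      _ = (s ^ (α + 1) * W) * (C * M * r * (1 / t * N + (1 / √T) * r * N ^ 2)) := by ring
      _ ≤ (√s * G) * (C * M * r * (1 / t * N + (1 / √T) * r * N ^ 2)) := by gcongr
      _ = G * C * M * r * (√s * (1 / t) * N + (√s * (1 / √T)) * r * N ^ 2) := by ring
      _ ≤ G * C * M * r * (r * (1 / t) * N ^ 2 + (1 / t) * r * N ^ 2) := by gcongr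
      _ = 2 * C * Real.exp (1 / 4) * S * (r * r * r * r *
            ((4 * N) ^ (α + 1 / 2) * N ^ 2 * Real.exp (-(N / 4)))) := by
          rw [← hr2, hM, hG]; ring
      _ ≤ 2 * C * Real.exp (1 / 4) * S * (K 2 * (t + (x - y) ^ 2) ^ (-2 : ℝ)) := by gcongr
      _ ≤ 2 * C * Real.exp (1 / 4) * S *
            ((K (3 / 2) + K 2) * (t + (x - y) ^ 2) ^ (-2 : ℝ)) := by gcongr; linarith
      _ = _ := by ring
  rw [← hrt]
  refine ⟨?_, ?_, ?_⟩
  · have hNN : N ≤ N ^ 2 := by rw [sq]; exact le_mul_of_one_le_left hN0.le hN1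
    calc |conjIntegrand α b t x y| * r
        = s ^ (α + 1) * (M * |conjBracket α b t x y|) * r := by
          rw [conjIntegrand, abs_mul, abs_mul, abs_of_pos hsp, abs_of_pos hMpos]
      _ ≤ s ^ (α + 1) * (M * (C * W * (r * N))) * r := by gcongr
      _ = (s ^ (α + 1) * W) * (C * M * r * r * N) := by ring
      _ ≤ (√s * G) * (C * M * r * r * N) := by gcongr
      _ ≤ (r * G) * (C * M * r * r * N ^ 2) := by gcongr
      _ = C * Real.exp (1 / 4) * S * (r * r * r *
            ((4 * N) ^ (α + 1 / 2) * N ^ 2 * Real.exp (-(N / 4)))) := by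
          rw [hM, hG]; ring
      _ ≤ C * Real.exp (1 / 4) * S * (K (3 / 2) * (t + (x - y) ^ 2) ^ (-(3 / 2) : ℝ)) := by
          gcongr
      _ ≤ (2 * C) * Real.exp (1 / 4) * S *
            ((K (3 / 2) + K 2) * (t + (x - y) ^ 2) ^ (-(3 / 2) : ℝ)) := by
          gcongr <;> linarith
      _ = _ := by ring
  · refine hgrad _ _ _ h2 h1 ?_
    have := abs_add_le (T * (x + y)) ((x - y) / T)
    rw [abs_div, abs_of_pos (show (0 : ℝ) < 2 by norm_num), div_le_iff₀ (by norm_num)]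
    linarith
  · refine hgrad _ _ _ h3 h1 ?_
    have := abs_sub (T * (x + y)) ((x - y) / T)
    rw [abs_div, abs_of_pos (show (0 : ℝ) < 2 by norm_num), div_le_iff₀ (by norm_num)]
    linarith

/-! ### The measure of a ball -/

lemma mu_ball {α : ℝ} (x r : ℝ) :
    mu α (Metric.ball x r) =
      ∫⁻ z in Metric.ball x r ∩ Set.Ioi 0, ENNReal.ofReal (z ^ (2 * α + 1)) := by
  rw [mu, withDensity_apply _ measurableSet_ball, Measure.restrict_restrict measurableSet_ball]

/-- The measure stands in the denominator of the goal, so only an upper bound and positivity are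
required. Every z in the ball is below 2(x + y), and 2α + 1 ≥ 0. -/
lemma mu_ball_le {α : ℝ} (hα : -(1 / 2) ≤ α) {x y : ℝ} (hx : 0 < x) (hy : 0 < y) :
    mu α (Metric.ball x |x - y|) ≤
      ENNReal.ofReal ((2 * (x + y)) ^ (2 * α + 1) * (2 * |x - y|)) := by
  rw [mu_ball]
  have hle : |x - y| ≤ x + y := by rw [abs_le]; constructor <;> linarith
  calc ∫⁻ z in Metric.ball x |x - y| ∩ Set.Ioi 0, ENNReal.ofReal (z ^ (2 * α + 1))
      ≤ ∫⁻ _ in Metric.ball x |x - y| ∩ Set.Ioi 0,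
          ENNReal.ofReal ((2 * (x + y)) ^ (2 * α + 1)) := by
        refine setLIntegral_mono' (measurableSet_ball.inter measurableSet_Ioi) fun z hz => ?_
        have h1 := (abs_lt.1 (Metric.mem_ball.1 hz.1)).2
        have h0 : 0 < z := hz.2
        gcongr
        · linarith
        · linarith
    _ ≤ ENNReal.ofReal ((2 * (x + y)) ^ (2 * α + 1)) * volume (Metric.ball x |x - y|) := by
        rw [setLIntegral_const]
        gcongr
        exact Set.inter_subset_left
    _ = _ := by
        rw [Real.volume_ball, ← ENNReal.ofReal_mul (by positivity)]

lemma mu_ball_pos {α : ℝ} (hα : -(1 / 2) ≤ α) {x r : ℝ} (hx : 0 < x) (hr : 0 < r) :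
    0 < mu α (Metric.ball x r) := by
  rw [mu_ball]
  have h : ∫⁻ _ in Set.Ioo x (x + r), ENNReal.ofReal (x ^ (2 * α + 1)) ≤
      ∫⁻ z in Metric.ball x r ∩ Set.Ioi 0, ENNReal.ofReal (z ^ (2 * α + 1)) := by
    calc ∫⁻ _ in Set.Ioo x (x + r), ENNReal.ofReal (x ^ (2 * α + 1))
        ≤ ∫⁻ z in Set.Ioo x (x + r), ENNReal.ofReal (z ^ (2 * α + 1)) := by
          refine setLIntegral_mono' measurableSet_Ioo fun z hz => ?_
          gcongr
          · linarith
          · exact hz.1.le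
      _ ≤ _ := by
          refine lintegral_mono_set fun z hz => ⟨?_, hx.trans hz.1⟩
          rw [Metric.mem_ball, Real.dist_eq, abs_lt]
          constructor <;> linarith [hz.1, hz.2]
  refine lt_of_lt_of_le ?_ h
  rw [setLIntegral_const, Real.volume_Ioo]
  refine ENNReal.mul_pos ?_ ?_
  · rw [Ne, ENNReal.ofReal_eq_zero, not_le]; positivity
  · rw [Ne, ENNReal.ofReal_eq_zero, not_le]; linarith

lemma mu_real_ball_bounds {α : ℝ} (hα : -(1 / 2) ≤ α) {x y : ℝ} (hx : 0 < x) (hy : 0 < y)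
    (hxy : x ≠ y) :
    0 < (mu α).real (Metric.ball x |x - y|) ∧
      (x + y) ^ (-(2 * α + 1)) / |x - y| ≤
        2 ^ (2 * α + 2) / (mu α).real (Metric.ball x |x - y|) := by
  have hD : 0 < |x - y| := abs_pos.2 (sub_ne_zero.2 hxy)
  have h1 := mu_ball_le hα hx hy
  have hpos : 0 < (mu α).real (Metric.ball x |x - y|) :=
    ENNReal.toReal_pos (mu_ball_pos hα hx hD).ne' (h1.trans_lt ENNReal.ofReal_lt_top).ne
  refine ⟨hpos, ?_⟩
  have h2 : (mu α).real (Metric.ball x |x - y|) ≤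
      (2 * (x + y)) ^ (2 * α + 1) * (2 * |x - y|) :=
    ENNReal.toReal_le_of_le_ofReal (by positivity) h1
  have hS : 0 < (x + y) ^ (2 * α + 1) := by positivity
  rw [div_le_div_iff₀ hD hpos, Real.rpow_neg (by positivity), inv_mul_le_iff₀ hS]
  refine h2.trans (le_of_eq ?_)
  rw [Real.mul_rpow (by norm_num) (by positivity), show 2 * α + 2 = 2 * α + 1 + 1 by ring,
    Real.rpow_add_one (by norm_num : (2 : ℝ) ≠ 0) (2 * α + 1)]
  ring

/-! ### The kernel as an integral -/

lemma integrableOn_add_rpow {θ κ : ℝ} (hθ : 1 < θ) (hκ : 0 < κ) :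
    IntegrableOn (fun t : ℝ => (t + κ) ^ (-θ)) (Set.Ioi 0) :=
  integrableOn_add_rpow_Ioi_of_lt (by linarith) (by linarith)

lemma integral_add_rpow {θ κ : ℝ} (hθ : 1 < θ) (hκ : 0 < κ) :
    ∫ t in Set.Ioi (0 : ℝ), (t + κ) ^ (-θ) = κ ^ (1 - θ) / (θ - 1) := by
  have h := (measurePreserving_add_right (volume : Measure ℝ) κ).setIntegral_preimage_emb
    (measurableEmbedding_addRight κ) (fun t => t ^ (-θ)) (Set.Ioi κ)
  rw [Set.preimage_add_const_Ioi, sub_self] at h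
  rw [h, integral_Ioi_rpow_of_lt (by linarith) hκ, show -θ + 1 = 1 - θ by ring,
    show θ - 1 = -(1 - θ) by ring, div_neg, neg_div]

lemma rieszIntegrand_eq {α b t x y : ℝ} (hb : -(1 / 2) ≤ α + b) (ht : 0 < t) (hx : 0 < x)
    (hy : 0 < y) :
    rieszIntegrand (α + b) x y t =
      (x * y) ^ (-b) * (conjIntegrand α b t x y * t ^ (-(1 / 2) : ℝ)) := by
  have hxy : 0 < x * y := mul_pos hx hy
  rw [rieszIntegrand, ← conjIntegrand_eq hb ht hx hy, Real.rpow_neg hxy.le]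
  field_simp

lemma conjKernel_eq {α b x y : ℝ} (hb : -(1 / 2) ≤ α + b) (hx : 0 < x) (hy : 0 < y) :
    conjKernel α b x y = 1 / √Real.pi *
      ∫ t in Set.Ioi (0 : ℝ), conjIntegrand α b t x y * t ^ (-(1 / 2) : ℝ) := by
  have hxy : 0 < x * y := mul_pos hx hy
  have e : ∫ t in Set.Ioi (0 : ℝ), rieszIntegrand (α + b) x y t =
      (x * y) ^ (-b) * ∫ t in Set.Ioi (0 : ℝ), conjIntegrand α b t x y * t ^ (-(1 / 2) : ℝ) := by
    rw [← integral_const_mul]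
    exact setIntegral_congr_fun measurableSet_Ioi fun t ht => rieszIntegrand_eq hb ht hx hy
  rw [conjKernel, rieszKernel, e, Real.rpow_neg hxy.le]
  field_simp

lemma continuousOn_rpow_neg_half : ContinuousOn (fun t : ℝ => t ^ (-(1 / 2) : ℝ)) (Set.Ioi 0) :=
  continuousOn_id.rpow_const fun _ ht => Or.inl (ne_of_gt ht)

lemma aestronglyMeasurable_conjIntegrand {α b x y : ℝ} (hα : -(1 / 2) ≤ α) (hb : 0 ≤ b)
    (hx : 0 < x) (hy : 0 < y) :
    AEStronglyMeasurable (fun t => conjIntegrand α b t x y * t ^ (-(1 / 2) : ℝ))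
      (volume.restrict (Set.Ioi 0)) :=
  ((continuousOn_conjIntegrand hα hb hx hy).1.mul
    continuousOn_rpow_neg_half).aestronglyMeasurable measurableSet_Ioi

lemma integrableOn_conjIntegrand {α b x y : ℝ} (hα : -(1 / 2) ≤ α) (hb : b = 0 ∨ 1 ≤ b)
    (hx : 0 < x) (hy : 0 < y) (hxy : x ≠ y) :
    IntegrableOn (fun t => conjIntegrand α b t x y * t ^ (-(1 / 2) : ℝ)) (Set.Ioi 0) := by
  obtain ⟨C, -, H⟩ := conjIntegrand_bounds hα
  have hb0 : 0 ≤ b := by rcases hb with h | h <;> linarith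
  have hκ : 0 < (x - y) ^ 2 := by
    have := sub_ne_zero.2 hxy
    positivity
  refine Integrable.mono' ((integrableOn_add_rpow (θ := 3 / 2) (by norm_num) hκ).const_mul
    (C * (x + y) ^ (-(2 * α + 1)))) (aestronglyMeasurable_conjIntegrand hα hb0 hx hy)
    ((ae_restrict_iff' measurableSet_Ioi).2 (ae_of_all _ fun t ht => ?_))
  have ht' : 0 < t := ht
  rw [Real.norm_eq_abs, abs_mul, abs_of_pos (show 0 < t ^ (-(1 / 2) : ℝ) by positivity)]
  exact (H b t x y hb ht hx hy).1

lemma one_div_sqrt_pi_le : 1 / √Real.pi ≤ 1 := by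
  rw [div_le_one (Real.sqrt_pos.2 Real.pi_pos), Real.one_le_sqrt]
  linarith [Real.pi_gt_three]

/-- The size estimate of the kernel. -/
theorem abs_conjKernel_le {α : ℝ} (hα : -(1 / 2) ≤ α) :
    ∃ C : ℝ, 0 < C ∧ ∀ b x y : ℝ, (b = 0 ∨ 1 ≤ b) → 0 < x → 0 < y → x ≠ y →
      |conjKernel α b x y| ≤ C * ((x + y) ^ (-(2 * α + 1)) / |x - y|) := by
  obtain ⟨C, hC, H⟩ := conjIntegrand_bounds hα
  refine ⟨2 * C, by positivity, fun b x y hb hx hy hxy => ?_⟩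
  have hb0 : 0 ≤ b := by rcases hb with h | h <;> linarith
  have hD : 0 < |x - y| := abs_pos.2 (sub_ne_zero.2 hxy)
  have hκ : 0 < (x - y) ^ 2 := by rw [← sq_abs]; positivity
  have h1 : |∫ t in Set.Ioi (0 : ℝ), conjIntegrand α b t x y * t ^ (-(1 / 2) : ℝ)| ≤
      ∫ t in Set.Ioi (0 : ℝ),
        C * (x + y) ^ (-(2 * α + 1)) * (t + (x - y) ^ 2) ^ (-(3 / 2) : ℝ) := by
    rw [← Real.norm_eq_abs]
    refine norm_integral_le_of_norm_le ((integrableOn_add_rpow (by norm_num) hκ).const_mul _)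
      ((ae_restrict_iff' measurableSet_Ioi).2 (ae_of_all _ fun t ht => ?_))
    have ht' : 0 < t := ht
    rw [Real.norm_eq_abs, abs_mul, abs_of_pos (show 0 < t ^ (-(1 / 2) : ℝ) by positivity)]
    exact (H b t x y hb ht hx hy).1
  rw [integral_const_mul, integral_add_rpow (by norm_num) hκ] at h1
  have e : ((x - y) ^ 2) ^ (1 - 3 / 2 : ℝ) = 1 / |x - y| := by
    rw [← sq_abs, ← Real.rpow_natCast, ← Real.rpow_mul hD.le]
    norm_num
    rw [Real.rpow_neg_one]
  rw [e] at h1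
  rw [conjKernel_eq (by linarith) hx hy, abs_mul,
    abs_of_pos (show 0 < 1 / √Real.pi from one_div_pos.2 (Real.sqrt_pos.2 Real.pi_pos))]
  calc _ ≤ 1 * (C * (x + y) ^ (-(2 * α + 1)) * (1 / |x - y| / (3 / 2 - 1))) := by
        gcongr
        exact one_div_sqrt_pi_le
    _ = _ := by ring

/-- The integrand of `conjKernelPlane`. -/
def planeIntegrand (α b : ℝ) (q : EuclideanSpace ℝ (Fin 2)) (t : ℝ) : ℝ :=
  conjIntegrand α b t (q 0) (q 1) * t ^ (-(1 / 2) : ℝ)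

/-- The derivative of `planeIntegrand` in the point of the plane. -/
def planeIntegrandDeriv (α b : ℝ) (q : EuclideanSpace ℝ (Fin 2)) (t : ℝ) :
    EuclideanSpace ℝ (Fin 2) →L[ℝ] ℝ :=
  t ^ (-(1 / 2) : ℝ) •
    planeForm (conjIntegrandX α b t (q 0) (q 1)) (conjIntegrandY α b t (q 0) (q 1))

lemma aestronglyMeasurable_planeIntegrandDeriv {α b : ℝ} (hα : -(1 / 2) ≤ α) (hb : 0 ≤ b)
    {q : EuclideanSpace ℝ (Fin 2)} (hx : 0 < q 0) (hy : 0 < q 1) :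
    AEStronglyMeasurable (planeIntegrandDeriv α b q) (volume.restrict (Set.Ioi 0)) := by
  obtain ⟨-, c1, c2⟩ := continuousOn_conjIntegrand (α := α) (b := b) hα hb hx hy
  exact (continuousOn_rpow_neg_half.smul (continuous_planeForm.comp_continuousOn
      (c1.prodMk c2))).aestronglyMeasurable measurableSet_Ioi

lemma norm_planeIntegrandDeriv_le {α : ℝ} (hα : -(1 / 2) ≤ α) :
    ∃ C : ℝ, 0 < C ∧ ∀ (b t : ℝ) (q : EuclideanSpace ℝ (Fin 2)), (b = 0 ∨ 1 ≤ b) → 0 < t →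
      0 < q 0 → 0 < q 1 → ‖planeIntegrandDeriv α b q t‖ ≤
        C * (q 0 + q 1) ^ (-(2 * α + 1)) * (t + (q 0 - q 1) ^ 2) ^ (-2 : ℝ) := by
  obtain ⟨C, hC, H⟩ := conjIntegrand_bounds hα
  refine ⟨2 * C, by positivity, fun b t q hb ht hx hy => ?_⟩
  have htr : 0 < t ^ (-(1 / 2) : ℝ) := by positivity
  obtain ⟨-, h1, h2⟩ := H b t (q 0) (q 1) hb ht hx hy
  rw [planeIntegrandDeriv, norm_smul, Real.norm_eq_abs, abs_of_pos htr]
  have := mul_le_mul_of_nonneg_left (norm_planeForm_le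
    (conjIntegrandX α b t (q 0) (q 1)) (conjIntegrandY α b t (q 0) (q 1))) htr.le
  linarith

/-- On this neighbourhood one integrable function of t dominates all the gradients, as
differentiation under the integral requires. -/
lemma eventually_plane_bounds {p : EuclideanSpace ℝ (Fin 2)} (hx : 0 < p 0) (hy : 0 < p 1)
    (hxy : p 0 ≠ p 1) : ∀ᶠ q in 𝓝 p, 0 < q 0 ∧ 0 < q 1 ∧ (p 0 + p 1) / 2 < q 0 + q 1 ∧
      (p 0 - p 1) ^ 2 / 2 < (q 0 - q 1) ^ 2 := by
  have c0 : ContinuousAt (fun q : EuclideanSpace ℝ (Fin 2) => q 0) p := by fun_prop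
  have c1 : ContinuousAt (fun q : EuclideanSpace ℝ (Fin 2) => q 1) p := by fun_prop
  have hκ : 0 < (p 0 - p 1) ^ 2 := by
    have := sub_ne_zero.2 hxy
    positivity
  exact (c0.eventually_const_lt hx).and ((c1.eventually_const_lt hy).and
    (((c0.add c1).eventually_const_lt (half_lt_self (add_pos hx hy))).and
      (((c0.sub c1).pow 2).eventually_const_lt (half_lt_self hκ))))

lemma hasFDerivAt_integral_planeIntegrand {α b : ℝ} (hα : -(1 / 2) ≤ α) (hb : b = 0 ∨ 1 ≤ b)
    {p : EuclideanSpace ℝ (Fin 2)} (hx : 0 < p 0) (hy : 0 < p 1) (hxy : p 0 ≠ p 1) :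
    HasFDerivAt (fun q => ∫ t in Set.Ioi (0 : ℝ), planeIntegrand α b q t)
      (∫ t in Set.Ioi (0 : ℝ), planeIntegrandDeriv α b p t) p := by
  obtain ⟨C, hC, H⟩ := norm_planeIntegrandDeriv_le hα
  have hb0 : 0 ≤ b := by rcases hb with h | h <;> linarith
  have hS : 0 < (p 0 + p 1) / 2 := by positivity
  have hκ : 0 < (p 0 - p 1) ^ 2 / 2 := by
    have := sub_ne_zero.2 hxy
    positivity
  have hU := eventually_plane_bounds hx hy hxy
  refine hasFDerivAt_integral_of_dominated_of_fderiv_le (bound := fun t =>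
    C * ((p 0 + p 1) / 2) ^ (-(2 * α + 1)) * (t + (p 0 - p 1) ^ 2 / 2) ^ (-2 : ℝ)) hU
    ?_ (integrableOn_conjIntegrand hα hb hx hy hxy)
    (aestronglyMeasurable_planeIntegrandDeriv hα hb0 hx hy) ?_
    ((integrableOn_add_rpow (by norm_num) hκ).const_mul _) ?_
  · filter_upwards [hU] with q hq
    exact aestronglyMeasurable_conjIntegrand hα hb0 hq.1 hq.2.1
  · refine (ae_restrict_iff' measurableSet_Ioi).2 (ae_of_all _ fun t ht q hq => ?_)
    have ht' : 0 < t := ht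
    obtain ⟨hq1, hq2, hq3, hq4⟩ := hq
    have m1 : (q 0 + q 1) ^ (-(2 * α + 1)) ≤ ((p 0 + p 1) / 2) ^ (-(2 * α + 1)) :=
      Real.rpow_le_rpow_of_nonpos hS hq3.le (by linarith)
    have m2 : (t + (q 0 - q 1) ^ 2) ^ (-2 : ℝ) ≤ (t + (p 0 - p 1) ^ 2 / 2) ^ (-2 : ℝ) :=
      Real.rpow_le_rpow_of_nonpos (by positivity) (by linarith) (by norm_num)
    refine (H b t q hb ht hq1 hq2).trans ?_
    gcongr
  · refine (ae_restrict_iff' measurableSet_Ioi).2 (ae_of_all _ fun t ht q hq => ?_)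
    exact (hasFDerivAt_conjIntegrand hα hb0 ht hq.1 hq.2.1).mul_const _

lemma hasFDerivAt_conjKernelPlane {α b : ℝ} (hα : -(1 / 2) ≤ α) (hb : b = 0 ∨ 1 ≤ b)
    {p : EuclideanSpace ℝ (Fin 2)} (hx : 0 < p 0) (hy : 0 < p 1) (hxy : p 0 ≠ p 1) :
    HasFDerivAt (conjKernelPlane α b) ((1 / √Real.pi) •
      ∫ t in Set.Ioi (0 : ℝ), planeIntegrandDeriv α b p t) p := by
  have hb0 : 0 ≤ b := by rcases hb with h | h <;> linarith
  have h := (hasFDerivAt_integral_planeIntegrand hα hb hx hy hxy).const_mul (1 / √Real.pi)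
  refine h.congr_of_eventuallyEq ?_
  filter_upwards [eventually_plane_bounds hx hy hxy] with q hq
  exact conjKernel_eq (by linarith) hq.1 hq.2.1

/-- The estimate of the gradient of the kernel. -/
theorem norm_gradient_conjKernelPlane_le {α : ℝ} (hα : -(1 / 2) ≤ α) :
    ∃ C : ℝ, 0 < C ∧ ∀ b x y : ℝ, (b = 0 ∨ 1 ≤ b) → 0 < x → 0 < y → x ≠ y →
      ‖gradient (conjKernelPlane α b) !₂[x, y]‖ ≤
        C * ((x + y) ^ (-(2 * α + 1)) / |x - y|) / |x - y| := by
  obtain ⟨C, hC, H⟩ := norm_planeIntegrandDeriv_le hα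
  refine ⟨C, hC, fun b x y hb hx hy hxy => ?_⟩
  have hD : 0 < |x - y| := abs_pos.2 (sub_ne_zero.2 hxy)
  have hκ : 0 < (x - y) ^ 2 := by rw [← sq_abs]; positivity
  have hd := hasFDerivAt_conjKernelPlane (p := !₂[x, y]) hα hb hx hy hxy
  have h1 : ‖∫ t in Set.Ioi (0 : ℝ), planeIntegrandDeriv α b !₂[x, y] t‖ ≤
      ∫ t in Set.Ioi (0 : ℝ), C * (x + y) ^ (-(2 * α + 1)) * (t + (x - y) ^ 2) ^ (-2 : ℝ) :=
    norm_integral_le_of_norm_le ((integrableOn_add_rpow (by norm_num) hκ).const_mul _)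
      ((ae_restrict_iff' measurableSet_Ioi).2 (ae_of_all _ fun t ht =>
        H b t !₂[x, y] hb ht hx hy))
  rw [integral_const_mul, integral_add_rpow (by norm_num) hκ] at h1
  have e : ((x - y) ^ 2) ^ (1 - 2 : ℝ) = 1 / |x - y| / |x - y| := by
    rw [show (1 - 2 : ℝ) = -1 by norm_num, Real.rpow_neg_one, ← sq_abs]
    field_simp
  rw [e] at h1
  rw [gradient, LinearIsometryEquiv.norm_map, hd.fderiv, norm_smul, Real.norm_eq_abs,
    abs_of_pos (show 0 < 1 / √Real.pi from one_div_pos.2 (Real.sqrt_pos.2 Real.pi_pos))]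
  calc _ ≤ 1 * (C * (x + y) ^ (-(2 * α + 1)) * (1 / |x - y| / |x - y| / (2 - 1))) := by
        gcongr
        exact one_div_sqrt_pi_le
    _ = _ := by ring

end

end LaguerreRiesz

/-! ### Assembly of the estimates. -/

theorem mainTheorem4 (α : ℝ) (hα : -(1 / 2) ≤ α) :
    ∃ C₁ C₂ : ℝ, ∀ a : ℝ, 1 ≤ a → ∀ j : ℕ, ∀ x y : ℝ, 0 < x → 0 < y → x ≠ y →
      -- the heat kernel, its derivative and the Riesz kernel are well defined
      ((∀ t : ℝ, 0 < t →
          Summable (LaguerreRiesz.heatTerm (α + a * j) t x y) ∧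
          DifferentiableAt ℝ (fun x' => LaguerreRiesz.heatKernel (α + a * j) t x' y) x) ∧
        MeasureTheory.IntegrableOn
          (LaguerreRiesz.rieszIntegrand (α + a * j) x y) (Set.Ioi 0)) ∧
      -- the size estimate
      |LaguerreRiesz.conjKernel α (a * j) x y| ≤
        C₁ / (LaguerreRiesz.mu α).real (Metric.ball x |x - y|) ∧
      -- the smoothness estimate
      DifferentiableAt ℝ (LaguerreRiesz.conjKernelPlane α (a * j)) !₂[x, y] ∧
      ‖gradient (LaguerreRiesz.conjKernelPlane α (a * j)) !₂[x, y]‖ ≤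
        C₂ / (|x - y| * (LaguerreRiesz.mu α).real (Metric.ball x |x - y|)) := by
  obtain ⟨K₁, hK₁, H₁⟩ := LaguerreRiesz.abs_conjKernel_le hα
  obtain ⟨K₂, hK₂, H₂⟩ := LaguerreRiesz.norm_gradient_conjKernelPlane_le hα
  refine ⟨K₁ * 2 ^ (2 * α + 2), K₂ * 2 ^ (2 * α + 2), fun a ha j x y hx hy hxy => ?_⟩
  -- This is where a ≥ 1 and the integrality of j enter: aj avoids the interval (0, 1).
  have hb : a * (j : ℝ) = 0 ∨ 1 ≤ a * (j : ℝ) := by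
    rcases Nat.eq_zero_or_pos j with rfl | hj
    · left; simp
    · right
      have : (1 : ℝ) ≤ j := by exact_mod_cast hj
      nlinarith
  set b := a * (j : ℝ)
  have hαb : -(1 / 2) ≤ α + b := by rcases hb with h | h <;> linarith
  have hD : 0 < |x - y| := abs_pos.2 (sub_ne_zero.2 hxy)
  obtain ⟨-, hμ⟩ := LaguerreRiesz.mu_real_ball_bounds hα hx hy hxy
  refine ⟨⟨fun t ht => ⟨(LaguerreRiesz.hasSum_heatTerm hαb ht x y).summable,
    (LaguerreRiesz.hasDerivAt_heatKernel hαb ht x y).differentiableAt⟩, ?_⟩, ?_, ?_, ?_⟩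
  · exact MeasureTheory.IntegrableOn.congr_fun
      ((LaguerreRiesz.integrableOn_conjIntegrand hα hb hx hy hxy).const_mul ((x * y) ^ (-b)))
      (fun t ht => (LaguerreRiesz.rieszIntegrand_eq hαb ht hx hy).symm) measurableSet_Ioi
  · refine (H₁ b x y hb hx hy hxy).trans ?_
    rw [mul_div_assoc]
    gcongr
  · exact (LaguerreRiesz.hasFDerivAt_conjKernelPlane hα hb (by simpa using hx)
      (by simpa using hy) (by simpa using hxy)).differentiableAt
  · refine (H₂ b x y hb hx hy hxy).trans ?_
    rw [mul_comm |x - y|, ← div_div, mul_div_assoc K₂ (2 ^ (2 * α + 2))]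
    gcongr
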